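/- Let $\theta_{hl}<\theta_+$ be real numbers, let $W\subset\mathbb R$ be an open set containing $[\theta_{hl},\theta_+]$, and let $F$ be a $C^\infty$ function on $W$ whose unique zero in $W$ is $\theta_+$ and which satisfies $F'(\theta_+)<0$. For $c\ge 0$ consider on $W\times\mathbb R$ the vector field $$X_c:\qquad u'=v,\qquad v'=cv-F(u),$$ and let $p_0=(\theta_+,0)$. Let the stable separatrix $S_c$ be the part of the stable manifold of $p_0$ lying in $[\theta_{hl},\theta_+]\times[0,\infty)$, that is, the set of points of $[\theta_{hl},\theta_+]\times[0,\infty)$ whose trajectory under $X_c$ exists in $W\times\mathbb R$ for all $t\ge 0$ and tends to $p_0$ as $t\to+\infty$. Then for every $c\ge 0$ the set $S_c$ is the graph $\{(u,v(u,c)) : u\in[\theta_{hl},\theta_+]\}$ of a function $v(\cdot,c)$, with $v(u,c)>0$ for $u\in[\theta_{hl},\theta_+)$. There is a trajectory $\gamma_c(t)=(u_\gamma(t,c),v_\gamma(t,c))$, $t\ge0$, of $X_c$ in $W\times\mathbb R$ with $\gamma_c(0)=(\theta_{hl},v(\theta_{hl},c))$ and $\gamma_c(t)\to p_0$ as $t\to+\infty$.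 For any such trajectory and any $u\in[\theta_{hl},\theta_+)$ there is exactly one time $t(u)\ge 0$ with $u_\gamma(t(u),c)=u$. Moreover, for all $u\in[\theta_{hl},\theta_+)$ and $c\ge 0$, the function $c\mapsto v(u,c)$ on $[0,\infty)$ is differentiable at $c$ (from the right if $c=0$), the integral below converges, and $$\partial_c v(u,c)=-\frac{1}{v(u,c)}\int_0^{\infty}e^{-ct}\,v_\gamma\bigl(t+t(u),c\bigr)^2\,dt .$$ In particular $\partial_c v(u,c)<0$. -/

import Mathlib

open Set Filter Topology MeasureTheory
open scoped ContDiff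

namespace Separatrix

/-- The planar vector field `X_c (u, v) = (v, c v - F u)`. -/
def field (F : ℝ → ℝ) (c : ℝ) (p : ℝ × ℝ) : ℝ × ℝ :=
  (p.2, c * p.2 - F p.1)

/-- `γ` restricted to `[0, ∞)` is a trajectory of `X_c` in the strip `W × ℝ`
(the derivative at `t = 0` is one-sided; values at negative times are irrelevant). -/
structure IsForwardTrajectory (F : ℝ → ℝ) (W : Set ℝ) (c : ℝ) (γ : ℝ → ℝ × ℝ) : Prop where
  mem : ∀ t, 0 ≤ t → (γ t).1 ∈ W
  ode : ∀ t, 0 ≤ t → HasDerivWithinAt γ (field F c (γ t)) (Ici 0) t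

/-- The stable manifold, in the strip `W × ℝ`, of the point `(θp, 0)` for the field `X_c`:
the points whose forward trajectory stays in the strip and tends to `(θp, 0)`. -/
def stableManifold (F : ℝ → ℝ) (W : Set ℝ) (θp c : ℝ) : Set (ℝ × ℝ) :=
  {p | ∃ γ : ℝ → ℝ × ℝ, IsForwardTrajectory F W c γ ∧ γ 0 = p ∧
    Tendsto γ atTop (𝓝 (θp, 0))}

/-- The stable separatrix `S_c`: the part of the stable manifold of `(θp, 0)` that lies in
`[θhl, θp] × [0, ∞)`. -/
def stableSeparatrix (F : ℝ → ℝ) (W : Set ℝ) (θhl θp c : ℝ) : Set (ℝ × ℝ) :=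
  stableManifold F W θp c ∩ Icc θhl θp ×ˢ Ici 0

/-- The number `v(u, c)`: the ordinate of the point of `S_c` above `u`. (The supremum only
serves to name that point; that there is exactly one is part of the theorem.) -/
noncomputable def height (F : ℝ → ℝ) (W : Set ℝ) (θhl θp u c : ℝ) : ℝ :=
  sSup {y | (u, y) ∈ stableSeparatrix F W θhl θp c}

/-- `γ` is the trajectory `γ_c` running along the separatrix: it starts at
`(θhl, v(θhl, c))` at time `0` and tends to `(θp, 0)`. -/
structure IsSeparatrixTrajectory (F : ℝ → ℝ) (W : Set ℝ) (θhl θp c : ℝ)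
    (γ : ℝ → ℝ × ℝ) : Prop where
  traj : IsForwardTrajectory F W c γ
  init : γ 0 = (θhl, height F W θhl θp θhl c)
  lim : Tendsto γ atTop (𝓝 (θp, 0))

end Separatrix

/-! Write b for θ_+. To the left of b, with v > 0, a trajectory tending to the saddle is a graph v =
V(u) with V' = c - F/V and V(b) = 0 (`IsProfile`). The proof constructs V, shows that every
trajectory in question follows it, and then differentiates in c. All estimates rest on V ≤ κ(b - u)
with κ independent of c.

Existence: the equation for V is singular at b, but P = V² solves P' = 2(c√P - F). The square root
is not Lipschitz at the initial value 0, so it is regularised and P is obtained as a monotone limit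
(`exists_sq_profile`).

Identification: over the interval where F > 0, (v - V(u))² has derivative 2(F/V)(v - V(u))² ≥ 0
along any trajectory. It tends to 0 if the trajectory tends to the saddle, so it vanishes
(`mem_profile`).

Derivative: along u' = V_c(u), the function e^{-ct}(V_{c'}² - V_c²)/2 has derivative e^{-ct}((c' -
c) V_c V_{c'} - (c/2)(V_{c'} - V_c)²); F has cancelled. Integrating over [0, ∞), dividing by c' - c
and letting c' → c by dominated convergence gives ∂_c(V²) = -2∫ e^{-ct} V_c(u)² dt
(`hasDerivWithinAt_profile`). -/

namespace Separatrix

/-! ### Existence of the profile through the equation for its square -/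

/-- A function on `[a, b]` which is `≤ 0` at `b` and nondecreasing wherever it is positive is
`≤ 0` everywhere. -/
theorem nonpos_of_deriv_nonneg_where_pos {h : ℝ → ℝ} {a b : ℝ} (hc : ContinuousOn h (Icc a b))
    (hb : h b ≤ 0)
    (hd : ∀ x ∈ Ioo a b, 0 < h x → ∃ d, 0 ≤ d ∧ HasDerivAt h d x) :
    ∀ x ∈ Icc a b, h x ≤ 0 := by
  intro x hx
  by_contra! hpos
  have hsub : Icc x b ⊆ Icc a b := Icc_subset_Icc_left hx.1
  have hcl : IsClosed (Icc x b ∩ h ⁻¹' Iic 0) :=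
    (hc.mono hsub).preimage_isClosed_of_isClosed isClosed_Icc isClosed_Iic
  have hcomp : IsCompact (Icc x b ∩ h ⁻¹' Iic 0) :=
    isCompact_Icc.of_isClosed_subset hcl inter_subset_left
  obtain ⟨y, ⟨hy, hy0⟩, hmin⟩ := hcomp.exists_isLeast ⟨b, ⟨hx.2, le_rfl⟩, hb⟩
  have hlt : ∀ z ∈ Ioo x y, 0 < h z := by
    intro z hz
    by_contra! hz0
    exact absurd (hmin ⟨⟨hz.1.le, hz.2.le.trans hy.2⟩, hz0⟩) (not_le.2 hz.2)
  have hder : ∀ z ∈ Ioo x y, ∃ d, 0 ≤ d ∧ HasDerivAt h d z := fun z hz =>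
    hd z ⟨hx.1.trans_lt hz.1, hz.2.trans_le hy.2⟩ (hlt z hz)
  have hmono : MonotoneOn h (Icc x y) := by
    apply monotoneOn_of_deriv_nonneg (convex_Icc _ _)
      (hc.mono ((Icc_subset_Icc_right hy.2).trans hsub))
    · rw [interior_Icc]
      intro z hz
      obtain ⟨d, -, hd⟩ := hder z hz
      exact hd.differentiableAt.differentiableWithinAt
    · rw [interior_Icc]
      intro z hz
      obtain ⟨d, hd0, hd⟩ := hder z hz
      rwa [hd.deriv]
  have := hmono ⟨le_rfl, hy.1⟩ ⟨hy.1, le_rfl⟩ hy.1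
  have h0 : h y ≤ 0 := hy0
  linarith

/-- A bounded regularisation of the square root: `√(ε + p)` with `p` clipped to `[0, M]`. -/
noncomputable def clippedSqrt (M ε p : ℝ) : ℝ := √(ε + max 0 (min M p))

theorem clippedSqrt_nonneg (M ε p : ℝ) : 0 ≤ clippedSqrt M ε p := Real.sqrt_nonneg _

theorem clippedSqrt_mono {M ε δ p q : ℝ} (h : ε ≤ δ) (hpq : p ≤ q) :
    clippedSqrt M ε p ≤ clippedSqrt M δ q := by
  unfold clippedSqrt; gcongr

theorem clippedSqrt_le {M ε p : ℝ} (hM : 0 ≤ M) (hε : ε ≤ 1) :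
    clippedSqrt M ε p ≤ √(1 + M) := by
  unfold clippedSqrt
  apply Real.sqrt_le_sqrt
  have : max 0 (min M p) ≤ M := max_le hM (min_le_left _ _)
  linarith

theorem clippedSqrt_zero {M p : ℝ} (hp : 0 ≤ p) (hM : p ≤ M) : clippedSqrt M 0 p = √p := by
  simp [clippedSqrt, hp, hM]

theorem continuous_clippedSqrt (M : ℝ) : Continuous fun x : ℝ × ℝ => clippedSqrt M x.1 x.2 := by
  unfold clippedSqrt; fun_prop

theorem abs_clippedSqrt_sub_le {M ε : ℝ} (hε : 0 < ε) (p q : ℝ) :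
    |clippedSqrt M ε p - clippedSqrt M ε q| ≤ (√ε)⁻¹ * |p - q| := by
  have hs : 0 < √ε := Real.sqrt_pos.2 hε
  have hP : ∀ p : ℝ, √ε ≤ clippedSqrt M ε p := fun p =>
    Real.sqrt_le_sqrt (le_add_of_nonneg_right (le_max_left _ _))
  have hsq : ∀ p : ℝ, clippedSqrt M ε p ^ 2 = ε + max 0 (min M p) := fun p =>
    Real.sq_sqrt (add_nonneg hε.le (le_max_left _ _))
  have h1 : |max 0 (min M p) - max 0 (min M q)| ≤ |p - q| :=
    (abs_max_sub_max_le_max 0 _ 0 _).trans (by simpa using abs_min_sub_min_le_max M p M q)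
  have h2 : |clippedSqrt M ε p - clippedSqrt M ε q| *
      (clippedSqrt M ε p + clippedSqrt M ε q) = |max 0 (min M p) - max 0 (min M q)| := by
    rw [← abs_of_pos (show 0 < clippedSqrt M ε p + clippedSqrt M ε q by
      linarith [hP p, hP q]), ← abs_mul]
    congr 1
    linear_combination hsq p - hsq q
  rw [inv_mul_eq_div, le_div_iff₀ hs]
  refine le_trans ?_ h1
  rw [← h2]
  gcongr
  linarith [hP p, hP q]

/-- Clipping makes the right-hand side bounded and ε > 0 makes it Lipschitz in P, so Picard–Lindelöf
applies on all of [a, b], backwards from b. -/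
theorem exists_regularised_profile {F : ℝ → ℝ} (hF : Continuous F) {a b c M ε : ℝ} (hab : a ≤ b)
    (hM : 0 ≤ M) (hε : 0 < ε) (hε1 : ε ≤ 1) (hc : 0 ≤ c) :
    ∃ P : ℝ → ℝ, P b = 0 ∧ ContinuousOn P (Icc a b) ∧
      ∀ x ∈ Ioo a b, HasDerivAt P (2 * (c * clippedSqrt M ε (P x) - F x)) x := by
  obtain ⟨B, hB⟩ := isCompact_Icc.exists_bound_of_continuousOn (s := Icc a b) hF.continuousOn
  have hB0 : 0 ≤ B := (norm_nonneg _).trans (hB a ⟨le_rfl, hab⟩)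
  set L : ℝ := 2 * (c * √(1 + M) + B) with hL
  have hL0 : 0 ≤ L := by positivity
  have hK0 : 0 ≤ 2 * (c * (√ε)⁻¹) := by positivity
  -- The ball of radius L(b - a) cannot be left within [a, b] at speed at most L, so no
  -- local-to-global extension is needed.
  have hR0 : 0 ≤ L * (b - a) := mul_nonneg hL0 (sub_nonneg.2 hab)
  have hpl : IsPicardLindelof (fun x p => 2 * (c * clippedSqrt M ε p - F x))
      (⟨b, hab, le_rfl⟩ : Icc a b) 0 (NNReal.mk _ hR0) 0 (NNReal.mk L hL0) (NNReal.mk _ hK0) := by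
    refine ⟨fun x _ => ?_, fun p _ => by fun_prop, fun x hx p _ => ?_, ?_⟩
    · refine (LipschitzWith.of_dist_le_mul fun p q => ?_).lipschitzOnWith
      rw [Real.dist_eq, Real.dist_eq, ← mul_sub, abs_mul, abs_two, NNReal.coe_mk, sub_sub_sub_cancel_right,
        ← mul_sub, abs_mul, abs_of_nonneg hc, mul_assoc, mul_assoc]
      gcongr
      exact abs_clippedSqrt_sub_le hε p q
    · rw [NNReal.coe_mk, norm_mul, Real.norm_ofNat, hL]
      gcongr
      refine (norm_sub_le _ _).trans (add_le_add ?_ (hB x hx))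
      rw [Real.norm_of_nonneg (mul_nonneg hc (clippedSqrt_nonneg _ _ _))]
      gcongr
      exact clippedSqrt_le hM hε1
    · simp [hab]
  obtain ⟨P, hP0, hP⟩ := hpl.exists_eq_forall_mem_Icc_hasDerivWithinAt₀
  exact ⟨P, hP0, fun x hx => (hP x hx).continuousWithinAt, fun x hx =>
    (hP x (Ioo_subset_Icc_self hx)).hasDerivAt (Icc_mem_nhds hx.1 hx.2)⟩

/-- By comparison from b, the regularised solutions increase as ε decreases and stay below C(b -
x)². Their limit satisfies the integral equation with ε = 0. This upper bound does not involve c. -/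
theorem exists_sq_profile {F : ℝ → ℝ} (hF : Continuous F) {a b c C : ℝ} (hab : a ≤ b)
    (hC : 0 ≤ C) (hFC : ∀ x ∈ Icc a b, F x ≤ C * (b - x)) (hF0 : ∀ x ∈ Ioo a b, 0 < F x)
    (hc : 0 ≤ c) :
    ∃ P : ℝ → ℝ, Continuous P ∧ P b = 0 ∧ (∀ x ∈ Icc a b, 0 ≤ P x ∧ P x ≤ C * (b - x) ^ 2) ∧
      (∀ x ∈ Ioo a b, 0 < P x) ∧ ∀ x ∈ Ioo a b, HasDerivAt P (2 * (c * √(P x) - F x)) x := by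
  set M : ℝ := C * (b - a) ^ 2 with hMdef
  have hM : 0 ≤ M := by positivity
  -- M is the maximum of C(b - x)² on [a, b], so the upper clip is inactive for the limit.
  have hε : ∀ n : ℕ, (0 : ℝ) < 1 / (n + 1) := fun n => Nat.one_div_pos_of_nat
  have hε1 : ∀ n : ℕ, (1 : ℝ) / (n + 1) ≤ 1 := fun n => by
    rw [div_le_one (by positivity)]; linarith [(Nat.cast_nonneg n : (0 : ℝ) ≤ n)]
  have hεlim : Tendsto (fun n : ℕ => (1 : ℝ) / (n + 1)) atTop (𝓝 0) :=
    tendsto_one_div_add_atTop_nhds_zero_nat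
  choose P hPb hPc hPd using fun n : ℕ =>
    exists_regularised_profile hF hab hM (hε n) (hε1 n) hc
  have hmono : ∀ n m, n ≤ m → ∀ x ∈ Icc a b, P n x ≤ P m x := by
    intro n m hnm x hx
    have := nonpos_of_deriv_nonneg_where_pos ((hPc n).sub (hPc m)) (by simp [hPb])
      (fun y hy hpos => ⟨_, ?_, (hPd n y hy).sub (hPd m y hy)⟩) x hx
    · simpa using this
    · have h1 : clippedSqrt M (1 / (m + 1)) (P m y) ≤ clippedSqrt M (1 / (n + 1)) (P n y) :=
        clippedSqrt_mono (Nat.one_div_le_one_div hnm) (by simpa using (sub_pos.1 hpos).le)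
      have := mul_le_mul_of_nonneg_left h1 hc
      linarith
  have hsq : ∀ x, HasDerivAt (fun y => C * (b - y) ^ 2) (-(2 * C * (b - x))) x := fun x => by
    have := (((hasDerivAt_id x).const_sub b).pow 2).const_mul C
    exact this.congr_deriv (by simp only [id]; norm_num; ring)
  have hupper : ∀ n, ∀ x ∈ Icc a b, P n x ≤ C * (b - x) ^ 2 := by
    intro n x hx
    have := nonpos_of_deriv_nonneg_where_pos
      (h := fun y => P n y - C * (b - y) ^ 2) ((hPc n).sub (by fun_prop)) (by simp [hPb])
      (fun y hy hpos => ⟨_, ?_, (hPd n y hy).sub (hsq y)⟩) x hx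
    · simpa using this
    · have h1 := hFC y (Ioo_subset_Icc_self hy)
      have h2 := mul_nonneg hc (clippedSqrt_nonneg M (1 / (n + 1)) (P n y))
      linarith
  -- Constant extension beyond [a, b] gives continuous functions on the line, hence a measurable
  -- pointwise limit.
  set Q : ℕ → ℝ → ℝ := fun n => IccExtend hab ((Icc a b).domRestrict (P n)) with hQ
  have hQc : ∀ n, Continuous (Q n) := fun n =>
    (continuousOn_iff_continuous_domRestrict.1 (hPc n)).Icc_extend'
  have hQP : ∀ n, ∀ x ∈ Icc a b, Q n x = P n x := fun n x hx => by
    simp [hQ, IccExtend_of_mem _ _ hx]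
  obtain ⟨R, hR⟩ : ∃ R : ℝ → ℝ, ∀ x, Tendsto (fun n => Q n x) atTop (𝓝 (R x)) := by
    refine ⟨fun x => ⨆ n, Q n x, fun x => tendsto_atTop_ciSup ?_ ⟨M, ?_⟩⟩
    · intro n m hnm
      exact hmono n m hnm _ (projIcc a b hab x).2
    · rintro _ ⟨n, rfl⟩
      have hp := (projIcc a b hab x).2
      refine (hupper n _ hp).trans ?_
      have h1 : 0 ≤ b - (projIcc a b hab x : ℝ) := sub_nonneg.2 hp.2
      have h2 : b - (projIcc a b hab x : ℝ) ≤ b - a := sub_le_sub_left hp.1 _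
      rw [hMdef]
      gcongr
  have hRm : Measurable R := measurable_of_tendsto_metrizable (fun n => (hQc n).measurable)
    (tendsto_pi_nhds.2 hR)
  have hgm : Continuous fun p : ℝ => clippedSqrt M 0 p := by unfold clippedSqrt; fun_prop
  set φ : ℝ → ℝ := fun x => 2 * (c * clippedSqrt M 0 (R x) - F x) with hφ
  have hφm : Measurable φ := by
    have := hgm.measurable.comp hRm
    exact ((this.const_mul c).sub hF.measurable).const_mul 2
  have hbound : ∀ ε ≤ 1, ∀ p x, ‖2 * (c * clippedSqrt M ε p - F x)‖
      ≤ 2 * (c * √(1 + M) + |F x|) := by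
    intro ε hε p x
    rw [norm_mul, Real.norm_ofNat]
    gcongr
    refine (norm_sub_le _ _).trans (add_le_add ?_ le_rfl)
    rw [Real.norm_of_nonneg (mul_nonneg hc (clippedSqrt_nonneg _ _ _))]
    gcongr
    exact clippedSqrt_le hM hε
  have hbc : Continuous fun x => 2 * (c * √(1 + M) + |F x|) := by fun_prop
  have hφi : ∀ x y, IntervalIntegrable φ volume x y := fun x y =>
    (hbc.intervalIntegrable x y).mono_fun hφm.aestronglyMeasurable
      (Eventually.of_forall fun z => (hbound 0 zero_le_one _ _).trans (le_abs_self _))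
  have hRφ : ∀ x ∈ Icc a b, R x = ∫ y in b..x, φ y := by
    intro x hx
    refine tendsto_nhds_unique (hR x) ?_
    have hsub : Icc x b ⊆ Icc a b := Icc_subset_Icc_left hx.1
    have key : ∀ n, Q n x = ∫ y in b..x, 2 * (c * clippedSqrt M (1 / (n + 1)) (Q n y) - F y) := by
      intro n
      have hcn : Continuous fun y => 2 * (c * clippedSqrt M (1 / (n + 1)) (Q n y) - F y) := by
        have := (continuous_clippedSqrt M).comp (continuous_const.prodMk (hQc n) :
          Continuous fun y => ((1 : ℝ) / (n + 1), Q n y))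
        exact continuous_const.mul ((continuous_const.mul this).sub hF)
      have := intervalIntegral.integral_eq_sub_of_hasDerivAt_of_le (f := P n)
        (f' := fun y => 2 * (c * clippedSqrt M (1 / (n + 1)) (Q n y) - F y)) hx.2
        ((hPc n).mono hsub) (fun y hy => ?_) (hcn.intervalIntegrable _ _)
      · rw [intervalIntegral.integral_symm, this, hPb, hQP n x hx]; ring
      · have hy' : y ∈ Ioo a b := ⟨hx.1.trans_lt hy.1, hy.2⟩
        simp only [hQP n y (Ioo_subset_Icc_self hy')]
        exact hPd n y hy'
    simp_rw [key]
    refine intervalIntegral.tendsto_integral_filter_of_dominated_convergence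
      (fun x => 2 * (c * √(1 + M) + |F x|)) (Eventually.of_forall fun n => ?_)
      (Eventually.of_forall fun n => Eventually.of_forall fun y _ => hbound _ (hε1 n) _ _)
      (hbc.intervalIntegrable _ _) (Eventually.of_forall fun y _ => ?_)
    · have := (continuous_clippedSqrt M).comp (continuous_const.prodMk (hQc n) :
          Continuous fun y => ((1 : ℝ) / (n + 1), Q n y))
      exact (continuous_const.mul ((continuous_const.mul this).sub hF)).aestronglyMeasurable
    · have := ((continuous_clippedSqrt M).tendsto (0, R y)).comp (hεlim.prodMk_nhds (hR y))
      exact ((this.const_mul c).sub_const _).const_mul 2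
  have hcont : Continuous fun x => ∫ y in b..x, φ y :=
    intervalIntegral.continuous_primitive hφi b
  have hder : ∀ x ∈ Ioo a b, HasDerivAt (fun x => ∫ y in b..x, φ y) (φ x) x := by
    intro x hx
    -- Bootstrap: R equals its own integral on [a, b], hence is continuous there, so the integrand
    -- is continuous and the integral differentiable.
    have hcφ : ContinuousAt φ x := by
      have : φ =ᶠ[𝓝 x] fun x => 2 * (c * clippedSqrt M 0 (∫ y in b..x, φ y) - F x) := by
        filter_upwards [Ioo_mem_nhds hx.1 hx.2] with z hz
        rw [← hRφ z (Ioo_subset_Icc_self hz)]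
      refine ContinuousAt.congr ?_ this.symm
      exact (continuous_const.mul ((continuous_const.mul (hgm.comp hcont)).sub hF)).continuousAt
    exact intervalIntegral.integral_hasDerivAt_right (hφi _ _)
      (hφm.stronglyMeasurable.stronglyMeasurableAtFilter) hcφ
  have hnonneg : ∀ x ∈ Icc a b, 0 ≤ ∫ y in b..x, φ y := by
    intro x hx
    have := nonpos_of_deriv_nonneg_where_pos (h := fun x => -∫ y in b..x, φ y)
      hcont.neg.continuousOn (by simp) (fun y hy hpos => ⟨_, ?_, (hder y hy).neg⟩) x hx
    · simpa using this
    · rw [← hRφ y (Ioo_subset_Icc_self hy)] at hpos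
      have hR0 : R y ≤ 0 := by linarith
      have : clippedSqrt M 0 (R y) = 0 := by
        simp [clippedSqrt, max_eq_left ((min_le_right M _).trans hR0)]
      simp only [hφ, this]
      linarith [hF0 y hy]
  have hle : ∀ x ∈ Icc a b, ∫ y in b..x, φ y ≤ C * (b - x) ^ 2 := by
    intro x hx
    rw [← hRφ x hx]
    refine le_of_tendsto (hR x) (Eventually.of_forall fun n => ?_)
    rw [hQP n x hx]
    exact hupper n x hx
  have hφeq : ∀ x ∈ Icc a b, φ x = 2 * (c * √(∫ y in b..x, φ y) - F x) := by
    intro x hx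
    have h0 := hnonneg x hx
    have h1 := hle x hx
    rw [← hRφ x hx] at h0 h1 ⊢
    have : R x ≤ M := by
      refine h1.trans ?_
      rw [hMdef]
      have := hx.1
      have : 0 ≤ b - x := sub_nonneg.2 hx.2
      gcongr
    rw [← clippedSqrt_zero h0 this]
  refine ⟨_, hcont, intervalIntegral.integral_same, fun x hx => ⟨hnonneg x hx, hle x hx⟩, ?_, ?_⟩
  · intro x hx
    refine lt_of_le_of_ne (hnonneg x (Ioo_subset_Icc_self hx)) fun h0 => ?_
    -- An interior zero would be a minimum of P, but there P' = -2F < 0.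
    have hmin : IsLocalMin (fun x => ∫ y in b..x, φ y) x := by
      filter_upwards [Ioo_mem_nhds hx.1 hx.2] with z hz
      rw [← h0]
      exact hnonneg z (Ioo_subset_Icc_self hz)
    have := hmin.hasDerivAt_eq_zero (hder x hx)
    rw [hφeq x (Ioo_subset_Icc_self hx), ← h0, Real.sqrt_zero] at this
    linarith [hF0 x hx]
  · intro x hx
    rw [← hφeq x (Ioo_subset_Icc_self hx)]
    exact hder x hx

/-- `V` is the graph over `[a, b]` of an orbit of `X_c` in the upper half-plane ending at
`(b, 0)`. The last clause bounds its slope at `b`. -/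
structure IsProfile (F : ℝ → ℝ) (a b κ c : ℝ) (V : ℝ → ℝ) : Prop where
  continuousOn : ContinuousOn V (Icc a b)
  right_eq : V b = 0
  pos : ∀ x ∈ Ioo a b, 0 < V x
  hasDerivAt : ∀ x ∈ Ioo a b, HasDerivAt V (c - F x / V x) x
  le : ∀ x ∈ Icc a b, V x ≤ κ * (b - x)

theorem exists_isProfile {F : ℝ → ℝ} {a b c C : ℝ} (hF : ContinuousOn F (Icc a b)) (hab : a ≤ b)
    (hC : 0 ≤ C) (hFC : ∀ x ∈ Icc a b, F x ≤ C * (b - x)) (hF0 : ∀ x ∈ Ioo a b, 0 < F x)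
    (hc : 0 ≤ c) : ∃ V, IsProfile F a b (√C) c V := by
  have hext : ∀ x ∈ Icc a b, IccExtend hab ((Icc a b).domRestrict F) x = F x := fun x hx => by
    simp [IccExtend_of_mem _ _ hx]
  obtain ⟨P, hPc, hPb, hP, hPpos, hPd⟩ := exists_sq_profile
    (F := IccExtend hab ((Icc a b).domRestrict F))
    (continuousOn_iff_continuous_domRestrict.1 hF).Icc_extend' hab hC
    (fun x hx => by rw [hext x hx]; exact hFC x hx)
    (fun x hx => by rw [hext x (Ioo_subset_Icc_self hx)]; exact hF0 x hx) hc
  refine ⟨fun x => √(P x), hPc.sqrt.continuousOn, by simp [hPb],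
    fun x hx => Real.sqrt_pos.2 (hPpos x hx), fun x hx => ?_, fun x hx => ?_⟩
  · convert (hPd x hx).sqrt (hPpos x hx).ne' using 1
    rw [hext x (Ioo_subset_Icc_self hx)]
    have := Real.sqrt_pos.2 (hPpos x hx)
    field_simp
  · rw [← Real.sqrt_sq (sub_nonneg.2 hx.2), ← Real.sqrt_mul hC]
    exact Real.sqrt_le_sqrt (hP x hx).2

/-! ### Motion along a profile -/

/-- `u` is a solution of `u' = V u` on `[0, ∞)` that stays in `[u 0, b)` and tends to `b`. -/
structure IsOrbit (V : ℝ → ℝ) (b : ℝ) (u : ℝ → ℝ) : Prop where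
  mem : ∀ t, 0 ≤ t → u t ∈ Ico (u 0) b
  continuousOn : ContinuousOn u (Ici 0)
  hasDerivAt : ∀ t, 0 < t → HasDerivAt u (V (u t)) t
  lim : Tendsto u atTop (𝓝 b)

namespace IsProfile

variable {F V : ℝ → ℝ} {a b κ c : ℝ}

theorem slope_pos (h : IsProfile F a b κ c V) {x : ℝ} (hx : x ∈ Ioo a b) : 0 < κ := by
  have h1 := (h.pos x hx).trans_le (h.le x (Ioo_subset_Icc_self hx))
  exact pos_of_mul_pos_left h1 (sub_pos.2 hx.2).le

theorem continuousAt (h : IsProfile F a b κ c V) {x : ℝ} (hx : x ∈ Ioo a b) :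
    ContinuousAt V x := (h.hasDerivAt x hx).continuousAt

/-- The solution of u' = V(u) is the inverse of the travel time T = ∫ 1/V. Since V ≤ κ(b - x), T
grows at least logarithmically near b, so the motion lasts for all time and never reaches b. -/
theorem exists_flow (h : IsProfile F a b κ c V) {x₀ : ℝ} (hx₀ : x₀ ∈ Ioo a b) :
    ∃ u : ℝ → ℝ, u 0 = x₀ ∧ (∀ t, 0 ≤ t → u t ∈ Ico x₀ b) ∧
      (∀ t, 0 ≤ t → HasDerivAt u (V (u t)) t) ∧ Tendsto u atTop (𝓝 b) := by
  have hκ := h.slope_pos hx₀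
  have hVc : ContinuousOn (fun x => (V x)⁻¹) (Ioo a b) := fun x hx =>
    ((h.continuousAt hx).inv₀ (h.pos x hx).ne').continuousWithinAt
  set T : ℝ → ℝ := fun x => ∫ y in x₀..x, (V y)⁻¹ with hT
  have hTd : ∀ x ∈ Ioo a b, HasDerivAt T (V x)⁻¹ x := fun x hx =>
    intervalIntegral.integral_hasDerivAt_right
      ((hVc.mono (ordConnected_Ioo.uIcc_subset hx₀ hx)).intervalIntegrable)
      (hVc.stronglyMeasurableAtFilter isOpen_Ioo x hx) (hVc.continuousAt (Ioo_mem_nhds hx.1 hx.2))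
  have hTc : ContinuousOn T (Ioo a b) := fun x hx => (hTd x hx).continuousAt.continuousWithinAt
  have hT0 : T x₀ = 0 := intervalIntegral.integral_same
  have hTm : StrictMonoOn T (Ioo a b) := by
    refine strictMonoOn_of_deriv_pos (convex_Ioo a b) hTc fun x hx => ?_
    rw [interior_Ioo] at hx
    rw [(hTd x hx).deriv]
    exact inv_pos.2 (h.pos x hx)
  -- the time needed to reach `x` is at least logarithmic in the distance to `b`
  have hlog : ∀ x ∈ Ico x₀ b, κ⁻¹ * (Real.log (b - x₀) - Real.log (b - x)) ≤ T x := by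
    have hd : ∀ x ∈ Ioo a b, HasDerivAt (fun x => T x + κ⁻¹ * Real.log (b - x))
        ((V x)⁻¹ + κ⁻¹ * (-1 / (b - x))) x := fun x hx =>
      (hTd x hx).add ((((hasDerivAt_id x).const_sub b).log (sub_pos.2 hx.2).ne').const_mul _)
    have hmono : MonotoneOn (fun x => T x + κ⁻¹ * Real.log (b - x)) (Ioo a b) := by
      refine monotoneOn_of_deriv_nonneg (convex_Ioo a b)
        (fun x hx => (hd x hx).continuousAt.continuousWithinAt)
        (fun x hx => (hd x (interior_subset hx)).differentiableAt.differentiableWithinAt)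
        fun x hx => ?_
      have hx := interior_subset hx
      rw [(hd x hx).deriv]
      have h1 : (κ * (b - x))⁻¹ ≤ (V x)⁻¹ :=
        inv_anti₀ (h.pos x hx) (h.le x (Ioo_subset_Icc_self hx))
      rw [mul_inv] at h1
      have : κ⁻¹ * (-1 / (b - x)) = -(κ⁻¹ * (b - x)⁻¹) := by ring
      linarith
    intro x hx
    have := hmono hx₀ ⟨hx₀.1.trans_le hx.1, hx.2⟩ hx.1
    simp only [hT0] at this
    linarith
  have hsurj : ∀ t, 0 ≤ t → t ∈ T '' Ioo a b := by
    intro t ht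
    -- The point at which the logarithmic lower bound for T equals t.
    set x₁ := b - (b - x₀) * Real.exp (-(κ * t)) with hx₁
    have hb0 : 0 < b - x₀ := sub_pos.2 hx₀.2
    have hx₁b : x₁ < b := by
      have := mul_pos hb0 (Real.exp_pos (-(κ * t)))
      linarith
    have hx₁0 : x₀ ≤ x₁ := by
      have : Real.exp (-(κ * t)) ≤ 1 := Real.exp_le_one_iff.2 (by
        have := mul_nonneg hκ.le ht; linarith)
      nlinarith
    have ht1 : t ≤ T x₁ := by
      refine le_trans (le_of_eq ?_) (hlog x₁ ⟨hx₁0, hx₁b⟩)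
      have : b - x₁ = (b - x₀) * Real.exp (-(κ * t)) := by rw [hx₁]; ring
      rw [this, Real.log_mul hb0.ne' (Real.exp_pos _).ne', Real.log_exp]
      field_simp
      ring
    have hsub : Icc x₀ x₁ ⊆ Ioo a b := Icc_subset_Ioo hx₀.1 hx₁b
    exact (image_mono hsub) (intermediate_value_Icc hx₁0 (hTc.mono hsub) ⟨hT0.trans_le ht, ht1⟩)
  have hopen : ∀ t ∈ T '' Ioo a b, T '' Ioo a b ∈ 𝓝 t := by
    rintro _ ⟨x, hx, rfl⟩
    obtain ⟨y, hy⟩ := exists_between hx.1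
    obtain ⟨z, hz⟩ := exists_between hx.2
    have hy' : y ∈ Ioo a b := ⟨hy.1, hy.2.trans hx.2⟩
    have hz' : z ∈ Ioo a b := ⟨hx.1.trans hz.1, hz.2⟩
    have hsub : Icc y z ⊆ Ioo a b := Icc_subset_Ioo hy.1 hz.2
    refine mem_of_superset (Icc_mem_nhds (hTm hy' hx hy.2) (hTm hx hz' hz.1)) ?_
    exact (intermediate_value_Icc (hy.2.trans hz.1).le (hTc.mono hsub)).trans (image_mono hsub)
  set u := Function.invFunOn T (Ioo a b) with hu
  have hum : ∀ t ∈ T '' Ioo a b, u t ∈ Ioo a b := fun t ht => Function.invFunOn_mem ht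
  have huT : ∀ t ∈ T '' Ioo a b, T (u t) = t := fun t ht => Function.invFunOn_eq ht
  have hTu : ∀ x ∈ Ioo a b, u (T x) = x := fun x hx =>
    hTm.injOn (hum _ ⟨x, hx, rfl⟩) hx (huT _ ⟨x, hx, rfl⟩)
  have hmono : StrictMonoOn u (T '' Ioo a b) := fun s hs t ht hst => by
    rw [← hTm.lt_iff_lt (hum s hs) (hum t ht), huT s hs, huT t ht]
    exact hst
  have himg : u '' (T '' Ioo a b) = Ioo a b := by
    rw [image_image]
    exact (image_congr hTu).trans (image_id' _)
  refine ⟨u, by rw [← hT0, hTu _ hx₀], fun t ht => ?_, fun t ht => ?_, ?_⟩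
  · have ht' := hsurj t ht
    refine ⟨?_, (hum t ht').2⟩
    rw [← hTm.le_iff_le hx₀ (hum t ht'), huT t ht', hT0]
    exact ht
  · have ht' := hsurj t ht
    have hx := hum t ht'
    have hc : ContinuousAt u t := hmono.continuousAt_of_image_mem_nhds (hopen t ht')
      (by rw [himg]; exact Ioo_mem_nhds hx.1 hx.2)
    have := HasDerivAt.of_local_left_inverse hc (hTd _ hx) (inv_ne_zero (h.pos _ hx).ne')
      (by filter_upwards [hopen t ht'] with s hs using huT s hs)
    rwa [inv_inv] at this
  · refine tendsto_order.2 ⟨fun y hy => ?_, fun y hy => ?_⟩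
    · have hz : max y x₀ ∈ Ioo a b := ⟨lt_max_of_lt_right hx₀.1, max_lt hy hx₀.2⟩
      filter_upwards [eventually_gt_atTop (T (max y x₀)), eventually_ge_atTop 0] with t ht ht0
      have := hmono ⟨_, hz, rfl⟩ (hsurj t ht0) ht
      rw [hTu _ hz] at this
      exact (le_max_left _ _).trans_lt this
    · filter_upwards [eventually_ge_atTop 0] with t ht
      exact (hum t (hsurj t ht)).2.trans hy

theorem exists_trajectory (h : IsProfile F a b κ c V) {W : Set ℝ} (hW : Icc a b ⊆ W) {x₀ : ℝ}
    (hx₀ : x₀ ∈ Ioo a b) :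
    ∃ γ : ℝ → ℝ × ℝ, IsForwardTrajectory F W c γ ∧ γ 0 = (x₀, V x₀) ∧
      Tendsto γ atTop (𝓝 (b, 0)) := by
  obtain ⟨u, hu0, hum, hud, hul⟩ := h.exists_flow hx₀
  have hmem : ∀ t, 0 ≤ t → u t ∈ Ioo a b := fun t ht =>
    ⟨hx₀.1.trans_le (hum t ht).1, (hum t ht).2⟩
  refine ⟨fun t => (u t, V (u t)), ⟨fun t ht => hW (Ioo_subset_Icc_self (hmem t ht)),
    fun t ht => ?_⟩, by simp [hu0], hul.prodMk_nhds ?_⟩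
  · have := (hud t ht).prodMk ((h.hasDerivAt _ (hmem t ht)).comp t (hud t ht))
    refine (this.congr_deriv ?_).hasDerivWithinAt
    have := (h.pos _ (hmem t ht)).ne'
    simp only [field, Prod.mk.injEq, true_and]
    field_simp
  · have := h.continuousOn b ⟨(hx₀.1.trans hx₀.2).le, le_rfl⟩
    rw [ContinuousWithinAt, h.right_eq] at this
    refine this.comp (tendsto_nhdsWithin_iff.2 ⟨hul, ?_⟩)
    filter_upwards [eventually_ge_atTop 0] with t ht
    exact Ioo_subset_Icc_self (hmem t ht)

end IsProfile

/-! ### Trajectories tending to the saddle follow the profile -/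

namespace IsForwardTrajectory

variable {F : ℝ → ℝ} {W : Set ℝ} {c b : ℝ} {γ : ℝ → ℝ × ℝ}

theorem hasDerivWithinAt_fst (h : IsForwardTrajectory F W c γ) {t : ℝ} (ht : 0 ≤ t) :
    HasDerivWithinAt (fun t => (γ t).1) (γ t).2 (Ici 0) t := by
  simpa [field] using (h.ode t ht).hasFDerivWithinAt.fst.hasDerivWithinAt

theorem hasDerivWithinAt_snd (h : IsForwardTrajectory F W c γ) {t : ℝ} (ht : 0 ≤ t) :
    HasDerivWithinAt (fun t => (γ t).2) (c * (γ t).2 - F (γ t).1) (Ici 0) t := by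
  simpa [field] using (h.ode t ht).hasFDerivWithinAt.snd.hasDerivWithinAt

theorem hasDerivAt_fst (h : IsForwardTrajectory F W c γ) {t : ℝ} (ht : 0 < t) :
    HasDerivAt (fun t => (γ t).1) (γ t).2 t :=
  (h.hasDerivWithinAt_fst ht.le).hasDerivAt (Ici_mem_nhds ht)

theorem hasDerivAt_snd (h : IsForwardTrajectory F W c γ) {t : ℝ} (ht : 0 < t) :
    HasDerivAt (fun t => (γ t).2) (c * (γ t).2 - F (γ t).1) t :=
  (h.hasDerivWithinAt_snd ht.le).hasDerivAt (Ici_mem_nhds ht)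

theorem continuousOn_fst (h : IsForwardTrajectory F W c γ) :
    ContinuousOn (fun t => (γ t).1) (Ici 0) := fun _ ht =>
  (h.hasDerivWithinAt_fst ht).continuousWithinAt

theorem continuousOn_snd (h : IsForwardTrajectory F W c γ) :
    ContinuousOn (fun t => (γ t).2) (Ici 0) := fun _ ht =>
  (h.hasDerivWithinAt_snd ht).continuousWithinAt

/-- The symmetry `(u, v) ↦ (-u, -v)`. -/
theorem neg (h : IsForwardTrajectory F W c γ) :
    IsForwardTrajectory (fun x => -F (-x)) (Neg.neg ⁻¹' W) c (fun t => -γ t) := by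
  refine ⟨fun t ht => by simpa using h.mem t ht, fun t ht => ?_⟩
  refine (h.ode t ht).neg.congr_deriv ?_
  ext <;> simp [field]
  ring

theorem shift (h : IsForwardTrajectory F W c γ) {τ : ℝ} (hτ : 0 ≤ τ) :
    IsForwardTrajectory F W c (fun t => γ (t + τ)) := by
  refine ⟨fun t ht => h.mem _ (add_nonneg ht hτ), fun t ht => ?_⟩
  have := (h.ode (t + τ) (add_nonneg ht hτ)).scomp t ((hasDerivAt_id t).add_const τ).hasDerivWithinAt
    (s := Ici 0) (fun s hs => add_nonneg hs hτ)
  rwa [one_smul] at this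

end IsForwardTrajectory

/-- A function with negative derivative is eventually smaller to the right. -/
theorem eventually_lt_of_hasDerivWithinAt_neg {f : ℝ → ℝ} {d t : ℝ} (ht : 0 ≤ t)
    (hf : HasDerivWithinAt f d (Ici 0) t) (hd : d < 0) : ∀ᶠ s in 𝓝[>] t, f s < f t := by
  have h1 := hf.mono (Ioi_subset_Ici ht : Ioi t ⊆ Ici 0)
  rw [hasDerivWithinAt_iff_tendsto_slope' self_notMem_Ioi] at h1
  filter_upwards [h1.eventually_lt_const hd, self_mem_nhdsWithin] with s hs hst
  rw [slope_def_field, div_neg_iff] at hs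
  have : t < s := hst
  rcases hs with hs | hs <;> linarith

namespace IsForwardTrajectory

variable {F : ℝ → ℝ} {W : Set ℝ} {c b : ℝ} {γ : ℝ → ℝ × ℝ}

/-- If v ≤ 0 at t₁, consider the time m where u is least on [t₁, ∞); it exists because u tends to b
> u(t₁). There v ≤ 0 and F > 0, so v' = cv - F < 0, and u drops below its minimum just after m. -/
theorem snd_pos (h : IsForwardTrajectory F W c γ) (hc : 0 ≤ c) (hF : ContinuousOn F W)
    (hzero : ∀ x ∈ W, F x = 0 → x = b) (hlim : Tendsto (fun t => (γ t).1) atTop (𝓝 b)) {t₁ : ℝ}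
    (ht₁ : 0 ≤ t₁) (hu : (γ t₁).1 < b) (hFu : 0 < F (γ t₁).1) : 0 < (γ t₁).2 := by
  by_contra! hv
  obtain ⟨T, hT⟩ := eventually_atTop.1 (hlim.eventually_const_lt hu)
  have hsub : ∀ s, Icc t₁ s ⊆ Ici 0 := fun s t ht => ht₁.trans ht.1
  obtain ⟨m, hm, hmin⟩ := isCompact_Icc.exists_isMinOn (nonempty_Icc.2 (le_max_left t₁ T))
    (h.continuousOn_fst.mono (hsub _))
  have hm0 : 0 ≤ m := ht₁.trans hm.1
  have hmin' : ∀ t, t₁ ≤ t → (γ m).1 ≤ (γ t).1 := by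
    intro t ht
    by_cases h2 : t ≤ max t₁ T
    · exact hmin ⟨ht, h2⟩
    · have h3 : (γ m).1 ≤ (γ t₁).1 := hmin ⟨le_rfl, le_max_left _ _⟩
      exact h3.trans (hT t ((le_max_right _ _).trans (not_le.1 h2).le)).le
  have hmu : (γ m).1 ≤ (γ t₁).1 := hmin' t₁ le_rfl
  have hFm : 0 < F (γ m).1 := by
    by_contra! hneg
    -- W need not be an interval, but every value between these two is visited by the trajectory.
    have hW : Icc (γ m).1 (γ t₁).1 ⊆ W := by
      intro x hx
      obtain ⟨s, hs, rfl⟩ := intermediate_value_Icc' hm.1 (h.continuousOn_fst.mono (hsub m)) hx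
      exact h.mem s (hsub m hs)
    obtain ⟨z, hz, hz0⟩ := intermediate_value_Icc hmu (hF.mono hW) ⟨hneg, hFu.le⟩
    linarith [hzero z (hW hz) hz0, hz.2]
  have hvm : (γ m).2 ≤ 0 := by
    rcases hm.1.eq_or_lt with rfl | hlt
    · exact hv
    · have : IsLocalMin (fun t => (γ t).1) m := by
        filter_upwards [Ioi_mem_nhds hlt] with t ht using hmin' t (le_of_lt ht)
      exact (this.hasDerivAt_eq_zero (h.hasDerivAt_fst (ht₁.trans_lt hlt))).le
  have hev := eventually_lt_of_hasDerivWithinAt_neg hm0 (h.hasDerivWithinAt_snd hm0)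
    (by nlinarith [mul_nonneg hc (neg_nonneg.2 hvm)])
  obtain ⟨s, hs, hsub'⟩ := (mem_nhdsGT_iff_exists_Ioo_subset).1 hev
  have hs : m < s := hs
  have hanti : StrictAntiOn (fun t => (γ t).1) (Icc m s) := by
    refine strictAntiOn_of_deriv_neg (convex_Icc _ _)
      (h.continuousOn_fst.mono fun t ht => hm0.trans ht.1) fun t ht => ?_
    rw [interior_Icc] at ht
    rw [(h.hasDerivAt_fst (hm0.trans_lt ht.1)).deriv]
    exact lt_of_lt_of_le (hsub' ht) hvm
  exact absurd (hanti ⟨le_rfl, hs.le⟩ ⟨hs.le, le_rfl⟩ hs)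
    (not_lt.2 (hmin' s (hm.1.trans hs.le)))

theorem snd_neg (h : IsForwardTrajectory F W c γ) (hc : 0 ≤ c) (hF : ContinuousOn F W)
    (hzero : ∀ x ∈ W, F x = 0 → x = b) (hlim : Tendsto (fun t => (γ t).1) atTop (𝓝 b)) {t₁ : ℝ}
    (ht₁ : 0 ≤ t₁) (hu : b < (γ t₁).1) (hFu : F (γ t₁).1 < 0) : (γ t₁).2 < 0 := by
  have := h.neg.snd_pos (b := -b) hc (hF.comp continuous_neg.continuousOn (mapsTo_preimage _ _)).neg
    (fun x hx hx0 => by linarith [hzero (-x) hx (by simpa using hx0)])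
    (by simpa using hlim.neg) ht₁ (by simpa using hu) (by simpa using hFu)
  simpa using this

/-- A trajectory tending to the saddle `(b, 0)` never crosses the line `u = b` upwards. -/
theorem snd_nonpos_of_fst_eq (h : IsForwardTrajectory F W c γ) (hc : 0 ≤ c)
    (hF : ContinuousOn F W) (hzero : ∀ x ∈ W, F x = 0 → x = b) (hright : ∀ᶠ x in 𝓝[>] b, F x < 0)
    (hlim : Tendsto (fun t => (γ t).1) atTop (𝓝 b)) {s : ℝ} (hs : 0 ≤ s) (hu : (γ s).1 = b) :
    (γ s).2 ≤ 0 := by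
  by_contra! hv
  -- With v > 0 on the line, the trajectory would enter u > b, F < 0 while v is still positive,
  -- contradicting `snd_neg`.
  have h1 : ∀ᶠ t in 𝓝[>] s, b < (γ t).1 := by
    have := eventually_lt_of_hasDerivWithinAt_neg hs (h.hasDerivWithinAt_fst hs).neg (by linarith)
    filter_upwards [this] with t ht
    have : -(γ t).1 < -(γ s).1 := ht
    linarith
  have hsub : Ioi s ⊆ Ici 0 := Ioi_subset_Ici hs
  have h2 : Tendsto (fun t => (γ t).1) (𝓝[>] s) (𝓝[>] b) := by
    refine tendsto_nhdsWithin_iff.2 ⟨?_, h1⟩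
    have := (h.continuousOn_fst s hs).mono hsub
    rwa [ContinuousWithinAt, hu] at this
  have h3 := ((h.continuousOn_snd s hs).mono hsub).eventually_const_lt hv
  obtain ⟨t, ⟨⟨ht1, ht2⟩, ht3⟩, hst⟩ :=
    (((h1.and (h2.eventually hright)).and h3).and self_mem_nhdsWithin).exists
  have := h.snd_neg hc hF hzero hlim (hs.trans (le_of_lt hst)) (by linarith) ht2
  linarith

variable {V : ℝ → ℝ} {a κ : ℝ}

/-- The gap w = v - V(u) satisfies w' = (F/V) w: trajectories are repelled from the profile. -/
theorem monotoneOn_sq_sub_profile (h : IsForwardTrajectory F W c γ) (hV : IsProfile F a b κ c V)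
    (hF0 : ∀ x ∈ Ioo a b, 0 < F x) {s : ℝ} (hmem : ∀ t ∈ Ico 0 s, (γ t).1 ∈ Ioo a b)
    (hs : (γ s).1 ∈ Icc a b) :
    MonotoneOn (fun t => ((γ t).2 - V (γ t).1) ^ 2) (Icc 0 s) := by
  have hsub : Icc 0 s ⊆ Ici 0 := Icc_subset_Ici_self
  have hmem' : MapsTo (fun t => (γ t).1) (Icc 0 s) (Icc a b) := by
    intro t ht
    rcases ht.2.eq_or_lt with rfl | hlt
    · exact hs
    · exact Ioo_subset_Icc_self (hmem t ⟨ht.1, hlt⟩)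
  have hd : ∀ t ∈ Ioo 0 s, HasDerivAt (fun t => ((γ t).2 - V (γ t).1) ^ 2)
      (2 * (F (γ t).1 / V (γ t).1) * ((γ t).2 - V (γ t).1) ^ 2) t := by
    intro t ht
    have hx := hmem t ⟨ht.1.le, ht.2⟩
    have hVd : HasDerivAt (fun t => V (γ t).1) _ t :=
      (hV.hasDerivAt _ hx).comp t (h.hasDerivAt_fst ht.1)
    refine (((h.hasDerivAt_snd ht.1).sub hVd).pow 2).congr_deriv ?_
    have := (hV.pos _ hx).ne'
    simp only [Pi.sub_apply]
    field_simp
    ring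
  refine monotoneOn_of_deriv_nonneg (convex_Icc _ _)
    (((h.continuousOn_snd.mono hsub).sub
      (hV.continuousOn.comp (h.continuousOn_fst.mono hsub) hmem')).pow 2) ?_ ?_
  · rw [interior_Icc]
    exact fun t ht => (hd t ht).differentiableAt.differentiableWithinAt
  · rw [interior_Icc]
    intro t ht
    have hx := hmem t ⟨ht.1.le, ht.2⟩
    rw [(hd t ht).deriv]
    have := div_pos (hF0 _ hx) (hV.pos _ hx)
    positivity

/-- A trajectory tending to the saddle that starts in the upper half-plane over `(a, b)` runs
along the profile. -/
theorem mem_profile (h : IsForwardTrajectory F W c γ) (hc : 0 ≤ c) (hF : ContinuousOn F W)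
    (hzero : ∀ x ∈ W, F x = 0 → x = b) (hright : ∀ᶠ x in 𝓝[>] b, F x < 0)
    (hV : IsProfile F a b κ c V) (hF0 : ∀ x ∈ Ioo a b, 0 < F x)
    (hlim : Tendsto γ atTop (𝓝 (b, 0))) (hu0 : (γ 0).1 ∈ Ioo a b) :
    ∀ t, 0 ≤ t → (γ t).1 ∈ Ico (γ 0).1 b ∧ (γ t).2 = V (γ t).1 := by
  have hlim1 : Tendsto (fun t => (γ t).1) atTop (𝓝 b) := (continuous_fst.tendsto _).comp hlim
  have hlim2 : Tendsto (fun t => (γ t).2) atTop (𝓝 0) := (continuous_snd.tendsto _).comp hlim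
  have hsub : ∀ s : ℝ, Icc 0 s ⊆ Ici 0 := fun s => Icc_subset_Ici_self
  have hpos : ∀ t, 0 ≤ t → (∀ s ∈ Icc 0 t, (γ s).1 < b) → 0 < (γ t).2 := by
    intro t ht hlt
    refine h.snd_pos hc hF hzero hlim1 ht (hlt t ⟨ht, le_rfl⟩) ?_
    by_contra! hneg
    have hcF : ContinuousOn (fun t => F (γ t).1) (Icc 0 t) :=
      hF.comp (h.continuousOn_fst.mono (hsub t)) fun s hs => h.mem s hs.1
    obtain ⟨s, hs, hs0⟩ := intermediate_value_Icc' ht hcF ⟨hneg, (hF0 _ hu0).le⟩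
    linarith [hlt s hs, hzero _ (h.mem s hs.1) hs0]
  have hmono : ∀ t, 0 ≤ t → (∀ s ∈ Icc 0 t, (γ s).1 < b) → (γ 0).1 ≤ (γ t).1 := by
    intro t ht hlt
    have : MonotoneOn (fun t => (γ t).1) (Icc 0 t) := by
      refine monotoneOn_of_deriv_nonneg (convex_Icc _ _) (h.continuousOn_fst.mono (hsub t)) ?_ ?_
      · rw [interior_Icc]
        exact fun s hs => (h.hasDerivAt_fst hs.1).differentiableAt.differentiableWithinAt
      · rw [interior_Icc]
        intro s hs
        rw [(h.hasDerivAt_fst hs.1).deriv]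
        exact (hpos s hs.1.le fun r hr => hlt r ⟨hr.1, hr.2.trans hs.2.le⟩).le
    exact this ⟨le_rfl, ht⟩ ⟨ht, le_rfl⟩ ht
  -- At a first arrival at u = b both sign conditions force v = 0, so the gap vanishes there and, by
  -- monotonicity, at all earlier times. Then u' = V(u) ≤ κ(b - u), so (b - u)e^{κt} is
  -- nondecreasing and cannot reach 0.
  have hlt : ∀ t, 0 ≤ t → (γ t).1 < b := by
    by_contra! hex
    obtain ⟨T, hT, hTb⟩ := hex
    have hcomp : IsCompact (Icc 0 T ∩ (fun t => (γ t).1) ⁻¹' Ici b) :=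
      isCompact_Icc.of_isClosed_subset
        ((h.continuousOn_fst.mono (hsub T)).preimage_isClosed_of_isClosed isClosed_Icc isClosed_Ici)
        inter_subset_left
    obtain ⟨s, ⟨hs, hsb⟩, hmin⟩ := hcomp.exists_isLeast ⟨T, ⟨hT, le_rfl⟩, hTb⟩
    have hsb : b ≤ (γ s).1 := hsb
    have hlts : ∀ r ∈ Ico 0 s, (γ r).1 < b := by
      intro r hr
      by_contra! hr'
      exact absurd (hmin ⟨⟨hr.1, hr.2.le.trans hs.2⟩, hr'⟩) (not_le.2 hr.2)
    have hsb' : (γ s).1 = b := by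
      obtain ⟨r, hr, hrb⟩ := intermediate_value_Icc hs.1 (h.continuousOn_fst.mono (hsub s))
        ⟨hu0.2.le, hsb⟩
      have : s ≤ r := hmin ⟨⟨hr.1, hr.2.trans hs.2⟩, hrb.ge⟩
      rwa [le_antisymm this hr.2]
    have hs0 : 0 < s := by
      refine lt_of_le_of_ne hs.1 fun h0 => ?_
      rw [← h0] at hsb'
      exact hu0.2.ne hsb'
    have hIcc : ∀ t ∈ Ico 0 s, ∀ r ∈ Icc 0 t, (γ r).1 < b := fun t ht r hr =>
      hlts r ⟨hr.1, hr.2.trans_lt ht.2⟩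
    have hmem : ∀ t ∈ Ico 0 s, (γ t).1 ∈ Ico (γ 0).1 b := fun t ht =>
      ⟨hmono t ht.1 (hIcc t ht), hlts t ht⟩
    have hvs : (γ s).2 = 0 := by
      refine le_antisymm (h.snd_nonpos_of_fst_eq hc hF hzero hright hlim1 hs.1 hsb') ?_
      have : Tendsto (fun t => (γ t).2) (𝓝[<] s) (𝓝 (γ s).2) :=
        (h.hasDerivAt_snd hs0).continuousAt.tendsto.mono_left nhdsWithin_le_nhds
      refine ge_of_tendsto this ?_
      filter_upwards [Ioo_mem_nhdsLT hs0] with t ht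
      exact (hpos t ht.1.le (hIcc t ⟨ht.1.le, ht.2⟩)).le
    have hDm := h.monotoneOn_sq_sub_profile hV hF0
      (fun t ht => ⟨hu0.1.trans_le (hmem t ht).1, (hmem t ht).2⟩)
      (by rw [hsb']; exact ⟨(hu0.1.trans hu0.2).le, le_rfl⟩)
    have hvV : ∀ t ∈ Icc 0 s, (γ t).2 = V (γ t).1 := by
      intro t ht
      have := hDm ht ⟨hs.1, le_rfl⟩ ht.2
      simp only [hsb', hvs, hV.right_eq] at this
      have := sq_nonneg ((γ t).2 - V (γ t).1)
      have : ((γ t).2 - V (γ t).1) ^ 2 = 0 := by linarith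
      linarith [pow_eq_zero_iff (two_ne_zero) |>.1 this]
    have hexp : MonotoneOn (fun t => (b - (γ t).1) * Real.exp (κ * t)) (Icc 0 s) := by
      have hd : ∀ t ∈ Ioo 0 s, HasDerivAt (fun t => (b - (γ t).1) * Real.exp (κ * t))
          ((κ * (b - (γ t).1) - (γ t).2) * Real.exp (κ * t)) t := by
        intro t ht
        refine (((h.hasDerivAt_fst ht.1).const_sub b).mul
          ((hasDerivAt_id t).const_mul κ).exp).congr_deriv ?_
        simp only [id]
        ring
      refine monotoneOn_of_deriv_nonneg (convex_Icc _ _) ?_ ?_ ?_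
      · exact (continuousOn_const.sub (h.continuousOn_fst.mono (hsub s))).mul
          (by fun_prop)
      · rw [interior_Icc]
        exact fun t ht => (hd t ht).differentiableAt.differentiableWithinAt
      · rw [interior_Icc]
        intro t ht
        have hx := hmem t ⟨ht.1.le, ht.2⟩
        rw [(hd t ht).deriv, hvV t (Ioo_subset_Icc_self ht)]
        exact mul_nonneg (sub_nonneg.2 (hV.le _ ⟨hu0.1.le.trans hx.1, hx.2.le⟩))
          (Real.exp_pos _).le
    have := hexp ⟨le_rfl, hs.1⟩ ⟨hs.1, le_rfl⟩ hs.1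
    simp only [hsb', sub_self, zero_mul, mul_zero, Real.exp_zero, mul_one] at this
    linarith [hu0.2]
  have hmem : ∀ t, 0 ≤ t → (γ t).1 ∈ Ico (γ 0).1 b := fun t ht =>
    ⟨hmono t ht fun r hr => hlt r hr.1, hlt t ht⟩
  have hmem' : ∀ t, 0 ≤ t → (γ t).1 ∈ Ioo a b := fun t ht =>
    ⟨hu0.1.trans_le (hmem t ht).1, hlt t ht⟩
  have hVlim : Tendsto (fun t => V (γ t).1) atTop (𝓝 0) := by
    have := hV.continuousOn b ⟨(hu0.1.trans hu0.2).le, le_rfl⟩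
    rw [ContinuousWithinAt, hV.right_eq] at this
    refine this.comp (tendsto_nhdsWithin_iff.2 ⟨hlim1, ?_⟩)
    filter_upwards [eventually_ge_atTop 0] with t ht
    exact Ioo_subset_Icc_self (hmem' t ht)
  refine fun t ht => ⟨hmem t ht, ?_⟩
  have hDlim : Tendsto (fun t => ((γ t).2 - V (γ t).1) ^ 2) atTop (𝓝 0) := by
    simpa using (hlim2.sub hVlim).pow 2
  have hle : ((γ t).2 - V (γ t).1) ^ 2 ≤ 0 := by
    refine ge_of_tendsto hDlim ?_
    filter_upwards [eventually_ge_atTop t] with s hs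
    exact h.monotoneOn_sq_sub_profile hV hF0 (fun r hr => hmem' r hr.1)
      (Ioo_subset_Icc_self (hmem' s (ht.trans hs))) ⟨ht, hs⟩ ⟨ht.trans hs, le_rfl⟩ hs
  have : ((γ t).2 - V (γ t).1) ^ 2 = 0 := le_antisymm hle (sq_nonneg _)
  linarith [pow_eq_zero_iff (two_ne_zero) |>.1 this]

end IsForwardTrajectory
-- Dependence of the profile on the speed
theorem integrableOn_mul_exp_neg {c : ℝ} (hc : 0 ≤ c) :
    IntegrableOn (fun t => c * Real.exp (-(c * t))) (Ioi 0) := by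
  -- At c = 0 the exponential is not integrable, but the factor c removes it.
  rcases hc.eq_or_lt with rfl | hc
  · simp
  · have := (integrableOn_exp_mul_Ioi (neg_lt_zero.2 hc) 0).const_mul c
    simp only [neg_mul] at this
    exact this

theorem exp_neg_mul_le_one {c t : ℝ} (hc : 0 ≤ c) (ht : 0 ≤ t) : Real.exp (-(c * t)) ≤ 1 :=
  Real.exp_le_one_iff.2 (neg_nonpos.2 (mul_nonneg hc ht))

theorem continuousOn_exp_neg (c : ℝ) (s : Set ℝ) :
    ContinuousOn (fun t => Real.exp (-(c * t))) s := by fun_prop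

namespace IsProfile

variable {F V V' : ℝ → ℝ} {a b κ c c' : ℝ}

theorem le_const (h : IsProfile F a b κ c V) {x : ℝ} (hx : x ∈ Ioo a b) :
    V x ≤ κ * (b - a) := by
  refine (h.le x (Ioo_subset_Icc_self hx)).trans ?_
  have := (h.slope_pos hx).le
  have := hx.1.le
  gcongr

theorem exists_orbit (h : IsProfile F a b κ c V) {x : ℝ} (hx : x ∈ Ioo a b) :
    ∃ u, IsOrbit V b u ∧ u 0 = x := by
  obtain ⟨u, hu0, hum, hud, hul⟩ := h.exists_flow hx
  exact ⟨u, ⟨by rwa [hu0], fun t ht => (hud t ht).continuousAt.continuousWithinAt,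
    fun t ht => hud t ht.le, hul⟩, hu0⟩

variable {u : ℝ → ℝ}

theorem orbit_mem (hu : IsOrbit V b u) (hu0 : u 0 ∈ Ioo a b) {t : ℝ} (ht : 0 ≤ t) :
    u t ∈ Ioo a b := ⟨hu0.1.trans_le (hu.mem t ht).1, (hu.mem t ht).2⟩

theorem continuousOn_comp_orbit (h' : IsProfile F a b κ c' V') (hu : IsOrbit V b u)
    (hu0 : u 0 ∈ Ioo a b) : ContinuousOn (fun t => V' (u t)) (Ici 0) :=
  h'.continuousOn.comp hu.continuousOn fun _ ht => Ioo_subset_Icc_self (orbit_mem hu hu0 ht)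

theorem tendsto_comp_orbit (h' : IsProfile F a b κ c' V') (hu : IsOrbit V b u)
    (hu0 : u 0 ∈ Ioo a b) : Tendsto (fun t => V' (u t)) atTop (𝓝 0) := by
  have := h'.continuousOn b ⟨(hu0.1.trans hu0.2).le, le_rfl⟩
  rw [ContinuousWithinAt, h'.right_eq] at this
  refine this.comp (tendsto_nhdsWithin_iff.2 ⟨hu.lim, ?_⟩)
  filter_upwards [eventually_ge_atTop 0] with t ht
  exact Ioo_subset_Icc_self (orbit_mem hu hu0 ht)

/-- V(u) is u', and u is bounded and increasing. This supplies the integrability at c = 0, where the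
weight e^{-ct} gives no decay. -/
theorem integrableOn_orbit (h : IsProfile F a b κ c V) (hu : IsOrbit V b u)
    (hu0 : u 0 ∈ Ioo a b) : IntegrableOn (fun t => V (u t)) (Ioi 0) :=
  integrableOn_Ioi_deriv_of_nonneg (hu.continuousOn 0 self_mem_Ici) hu.hasDerivAt
    (fun _ ht => (h.pos _ (orbit_mem hu hu0 (le_of_lt ht))).le) hu.lim

theorem integral_orbit (h : IsProfile F a b κ c V) (hu : IsOrbit V b u)
    (hu0 : u 0 ∈ Ioo a b) : ∫ t in Ioi 0, V (u t) = b - u 0 :=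
  integral_Ioi_of_hasDerivAt_of_nonneg (hu.continuousOn 0 self_mem_Ici) hu.hasDerivAt
    (fun _ ht => (h.pos _ (orbit_mem hu hu0 (le_of_lt ht))).le) hu.lim

theorem sq_sub_le (h : IsProfile F a b κ c V) (h' : IsProfile F a b κ c' V') {x : ℝ}
    (hx : x ∈ Ioo a b) : (V' x - V x) ^ 2 ≤ (κ * (b - a)) ^ 2 := by
  have h1 := h.le_const hx
  have h2 := h'.le_const hx
  have h3 := h.pos x hx
  have h4 := h'.pos x hx
  exact sq_le_sq' (by linarith) (by linarith)

/-- Along an orbit for the speed `c`, the weighted integrand measuring the gap between the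
profiles for the speeds `c` and `c'`. -/
noncomputable def gapIntegrand (c c' : ℝ) (V V' u : ℝ → ℝ) (t : ℝ) : ℝ :=
  Real.exp (-(c * t)) * ((c' - c) * (V (u t) * V' (u t)) - c / 2 * (V' (u t) - V (u t)) ^ 2)

theorem integrableOn_gapIntegrand (h : IsProfile F a b κ c V) (h' : IsProfile F a b κ c' V')
    (hc : 0 ≤ c) (hu : IsOrbit V b u) (hu0 : u 0 ∈ Ioo a b) :
    IntegrableOn (gapIntegrand c c' V V' u) (Ioi 0) := by
  have hcV := (h.continuousOn_comp_orbit hu hu0).mono Ioi_subset_Ici_self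
  have hcV' := (h'.continuousOn_comp_orbit hu hu0).mono Ioi_subset_Ici_self
  have hg : Integrable (fun t => |c' - c| * (κ * (b - a)) * V (u t) +
      (κ * (b - a)) ^ 2 / 2 * (c * Real.exp (-(c * t)))) (volume.restrict (Ioi 0)) :=
    ((h.integrableOn_orbit hu hu0).const_mul _).add ((integrableOn_mul_exp_neg hc).const_mul _)
  refine hg.mono' (ContinuousOn.aestronglyMeasurable ?_ measurableSet_Ioi) ?_
  · exact (continuousOn_exp_neg c _).mul
      ((continuousOn_const.mul (hcV.mul hcV')).sub (continuousOn_const.mul ((hcV'.sub hcV).pow 2)))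
  · refine (ae_restrict_iff' measurableSet_Ioi).2 (Eventually.of_forall fun t ht => ?_)
    have ht : 0 < t := ht
    have hx := orbit_mem hu hu0 ht.le
    have hV := (h.pos _ hx).le
    have hV' := (h'.pos _ hx).le
    have hE : Real.exp (-(c * t)) ≤ 1 := exp_neg_mul_le_one hc ht.le
    have h1 : ‖(c' - c) * (V (u t) * V' (u t))‖ ≤ |c' - c| * (κ * (b - a)) * V (u t) := by
      rw [norm_mul, Real.norm_eq_abs, Real.norm_of_nonneg (mul_nonneg hV hV'), mul_assoc,
        mul_comm (V (u t))]
      gcongr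
      exact h'.le_const hx
    have h2 : ‖c / 2 * (V' (u t) - V (u t)) ^ 2‖ ≤ c / 2 * (κ * (b - a)) ^ 2 := by
      rw [Real.norm_of_nonneg (by positivity)]
      gcongr ?_ * ?_
      exact h.sq_sub_le h' hx
    rw [gapIntegrand, mul_sub]
    refine (norm_sub_le _ _).trans (add_le_add ?_ ?_)
    · rw [norm_mul, Real.norm_of_nonneg (Real.exp_pos _).le]
      exact (mul_le_of_le_one_left (norm_nonneg _) hE).trans h1
    · rw [norm_mul, Real.norm_of_nonneg (Real.exp_pos _).le]
      refine (mul_le_mul_of_nonneg_left h2 (Real.exp_pos _).le).trans_eq ?_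
      ring

/-- `gapIntegrand` is the derivative of e^{-ct}(V'(u)² - V(u)²)/2, which tends to 0 because both
profiles vanish at b. -/
theorem integral_gapIntegrand (h : IsProfile F a b κ c V) (h' : IsProfile F a b κ c' V')
    (hc : 0 ≤ c) (hu : IsOrbit V b u) (hu0 : u 0 ∈ Ioo a b) :
    ∫ t in Ioi 0, gapIntegrand c c' V V' u t = (V (u 0) ^ 2 - V' (u 0) ^ 2) / 2 := by
  have hcV := h.continuousOn_comp_orbit hu hu0
  have hcV' := h'.continuousOn_comp_orbit hu hu0
  have key := integral_Ioi_of_hasDerivAt_of_tendsto (a := 0) (m := 0)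
    (f := fun t => Real.exp (-(c * t)) * ((V' (u t) ^ 2 - V (u t) ^ 2) / 2))
    (f' := gapIntegrand c c' V V' u) ?_ ?_ (h.integrableOn_gapIntegrand h' hc hu hu0) ?_
  · rw [key]
    simp only [mul_zero, neg_zero, Real.exp_zero]
    ring
  · have : ContinuousOn (fun t => Real.exp (-(c * t)) * ((V' (u t) ^ 2 - V (u t) ^ 2) / 2))
        (Ici 0) :=
      (continuousOn_exp_neg c _).mul (((hcV'.pow 2).sub (hcV.pow 2)).div_const 2)
    exact this 0 self_mem_Ici
  · intro t ht
    have ht : 0 < t := ht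
    have hx := orbit_mem hu hu0 ht.le
    have hV : HasDerivAt (fun t => V (u t)) _ t :=
      (h.hasDerivAt _ hx).comp t (hu.hasDerivAt t ht)
    have hV' : HasDerivAt (fun t => V' (u t)) _ t :=
      (h'.hasDerivAt _ hx).comp t (hu.hasDerivAt t ht)
    refine ((((hasDerivAt_id t).const_mul c).neg.exp).mul
      (((hV'.pow 2).sub (hV.pow 2)).div_const 2)).congr_deriv ?_
    have := (h.pos _ hx).ne'
    have := (h'.pos _ hx).ne'
    simp only [gapIntegrand, id, Pi.neg_apply, Pi.sub_apply, Pi.pow_apply]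
    field_simp
    ring
  · have h1 : Tendsto (fun t => (V' (u t) ^ 2 - V (u t) ^ 2) / 2) atTop (𝓝 0) := by
      simpa using (((h'.tendsto_comp_orbit hu hu0).pow 2).sub
        ((h.tendsto_comp_orbit hu hu0).pow 2)).div_const 2
    refine squeeze_zero_norm' (a := fun t => ‖(V' (u t) ^ 2 - V (u t) ^ 2) / 2‖) ?_
      (by simpa using h1.norm)
    filter_upwards [eventually_ge_atTop 0] with t ht
    rw [norm_mul, Real.norm_of_nonneg (Real.exp_pos _).le]
    exact mul_le_of_le_one_left (norm_nonneg _) (exp_neg_mul_le_one hc ht)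

/-- The profiles depend on the speed in a Lipschitz way. -/
theorem abs_sq_sub_sq_le (h : IsProfile F a b κ c V) (h' : IsProfile F a b κ c' V')
    (hc : 0 ≤ c) (hc' : 0 ≤ c') {x : ℝ} (hx : x ∈ Ioo a b) :
    |V' x ^ 2 - V x ^ 2| ≤ 2 * (κ * (b - a) ^ 2) * |c' - c| := by
  -- For c ≥ 0 the squared term in the gap integrand has a favourable sign and is dropped. This
  -- bounds one side; exchanging the two speeds bounds the other.
  have key : ∀ {c c' : ℝ} {V V' : ℝ → ℝ}, IsProfile F a b κ c V → IsProfile F a b κ c' V' →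
      0 ≤ c → V x ^ 2 - V' x ^ 2 ≤ 2 * (κ * (b - a) ^ 2) * |c' - c| := by
    intro c c' V V' h h' hc
    obtain ⟨u, hu, rfl⟩ := h.exists_orbit hx
    have hK : 0 ≤ κ * (b - a) := (h.pos _ hx).le.trans (h.le_const hx)
    have h1 : ∫ t in Ioi 0, gapIntegrand c c' V V' u t ≤
        ∫ t in Ioi 0, |c' - c| * (κ * (b - a)) * V (u t) := by
      refine setIntegral_mono_on (h.integrableOn_gapIntegrand h' hc hu hx)
        ((h.integrableOn_orbit hu hx).const_mul _) measurableSet_Ioi fun t ht => ?_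
      have ht : 0 < t := ht
      have hy := orbit_mem hu hx ht.le
      have hV := (h.pos _ hy).le
      have hV' := (h'.pos _ hy).le
      have hE : Real.exp (-(c * t)) ≤ 1 := exp_neg_mul_le_one hc ht.le
      have h2 : (c' - c) * (V (u t) * V' (u t)) - c / 2 * (V' (u t) - V (u t)) ^ 2
          ≤ |c' - c| * (κ * (b - a)) * V (u t) := by
        have h3 : 0 ≤ c / 2 * (V' (u t) - V (u t)) ^ 2 := by positivity
        have h4 : (c' - c) * (V (u t) * V' (u t)) ≤ |c' - c| * (V (u t) * (κ * (b - a))) := by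
          gcongr
          · exact le_abs_self _
          · exact h'.le_const hy
        linarith
      refine (mul_le_mul_of_nonneg_left h2 (Real.exp_pos _).le).trans ?_
      exact mul_le_of_le_one_left (by positivity) hE
    rw [h.integral_gapIntegrand h' hc hu hx, integral_const_mul, h.integral_orbit hu hx] at h1
    have h5 : |c' - c| * (κ * (b - a)) * (b - u 0) ≤ |c' - c| * (κ * (b - a)) * (b - a) := by
      have := hx.1.le
      gcongr
    linarith
  refine abs_sub_le_iff.2 ⟨?_, key h h' hc⟩
  rw [abs_sub_comm]
  exact key h' h hc'

/-- First order in c' - c, but degenerating as V → 0 at b: enough for pointwise limits along the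
orbit, not for domination. -/
theorem abs_sub_le (h : IsProfile F a b κ c V) (h' : IsProfile F a b κ c' V')
    (hc : 0 ≤ c) (hc' : 0 ≤ c') {x : ℝ} (hx : x ∈ Ioo a b) :
    |V' x - V x| ≤ 2 * (κ * (b - a) ^ 2) / V x * |c' - c| := by
  have hV := h.pos x hx
  have hV' := h'.pos x hx
  rw [div_mul_eq_mul_div, le_div_iff₀ hV]
  refine le_trans ?_ (h.abs_sq_sub_sq_le h' hc hc' hx)
  rw [show V' x ^ 2 - V x ^ 2 = (V' x - V x) * (V' x + V x) by ring, abs_mul,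
    abs_of_pos (add_pos hV' hV)]
  gcongr
  linarith

/-- Follows from |V' - V| ≤ V' + V. Being uniform in x, it dominates the quotient (V' - V)²/(c' - c)
along the whole orbit. -/
theorem sq_sub_le_mul (h : IsProfile F a b κ c V) (h' : IsProfile F a b κ c' V')
    (hc : 0 ≤ c) (hc' : 0 ≤ c') {x : ℝ} (hx : x ∈ Ioo a b) :
    (V' x - V x) ^ 2 ≤ 2 * (κ * (b - a) ^ 2) * |c' - c| := by
  have hV := h.pos x hx
  have hV' := h'.pos x hx
  refine le_trans ?_ (h.abs_sq_sub_sq_le h' hc hc' hx)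
  rw [show V' x ^ 2 - V x ^ 2 = (V' x - V x) * (V' x + V x) by ring, abs_mul,
    abs_of_pos (add_pos hV' hV), ← sq_abs, sq]
  gcongr
  exact abs_le.2 ⟨by linarith, by linarith⟩

theorem integrableOn_exp_mul_sq (h : IsProfile F a b κ c V) (hc : 0 ≤ c) (hu : IsOrbit V b u)
    (hu0 : u 0 ∈ Ioo a b) :
    IntegrableOn (fun t => Real.exp (-(c * t)) * V (u t) ^ 2) (Ioi 0) := by
  have hcV := (h.continuousOn_comp_orbit hu hu0).mono Ioi_subset_Ici_self
  refine ((h.integrableOn_orbit hu hu0).const_mul (κ * (b - a))).mono'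
    (((continuousOn_exp_neg c _).mul (hcV.pow 2)).aestronglyMeasurable measurableSet_Ioi)
    ((ae_restrict_iff' measurableSet_Ioi).2 (Eventually.of_forall fun t ht => ?_))
  have ht : 0 < t := ht
  have hx := orbit_mem hu hu0 ht.le
  have hV := h.pos _ hx
  have hE : Real.exp (-(c * t)) ≤ 1 := exp_neg_mul_le_one hc ht.le
  rw [Real.norm_of_nonneg (by positivity)]
  refine (mul_le_of_le_one_left (by positivity) hE).trans ?_
  rw [sq]
  gcongr
  exact h.le_const hx

theorem integral_exp_mul_sq_pos (h : IsProfile F a b κ c V) (hc : 0 ≤ c) (hu : IsOrbit V b u)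
    (hu0 : u 0 ∈ Ioo a b) : 0 < ∫ t in Ioi 0, Real.exp (-(c * t)) * V (u t) ^ 2 := by
  have hpos : ∀ t ∈ Ioi (0 : ℝ), 0 < Real.exp (-(c * t)) * V (u t) ^ 2 := fun t ht => by
    have := h.pos _ (orbit_mem hu hu0 (le_of_lt ht))
    positivity
  rw [setIntegral_pos_iff_support_of_nonneg_ae
    ((ae_restrict_iff' measurableSet_Ioi).2 (Eventually.of_forall fun t ht => (hpos t ht).le))
    (h.integrableOn_exp_mul_sq hc hu hu0),
    inter_eq_right.2 fun t ht => Function.mem_support.2 (hpos t ht).ne']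
  simp

end IsProfile

/-- Differentiability of the profile with respect to the speed. -/
theorem hasDerivWithinAt_profile {F : ℝ → ℝ} {a b κ c : ℝ} {V : ℝ → ℝ → ℝ} {u : ℝ → ℝ}
    (h : ∀ c, 0 ≤ c → IsProfile F a b κ c (V c)) (hc : 0 ≤ c) (hu : IsOrbit (V c) b u)
    (hu0 : u 0 ∈ Ioo a b) :
    HasDerivWithinAt (fun c' => V c' (u 0))
      (-(1 / V c (u 0)) * ∫ t in Ioi 0, Real.exp (-(c * t)) * V c (u t) ^ 2) (Ici 0) c := by
  have hcV : ∀ c', 0 ≤ c' → ContinuousOn (fun t => V c' (u t)) (Ioi 0) := fun c' hc' =>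
    ((h c' hc').continuousOn_comp_orbit hu hu0).mono Ioi_subset_Ici_self
  have hev : ∀ᶠ c' in 𝓝[Ici 0 \ {c}] c, c' ∈ Ici 0 \ {c} := self_mem_nhdsWithin
  set A := 2 * (κ * (b - a) ^ 2) with hA
  have hlim : Tendsto (fun c' => ∫ t in Ioi 0, Real.exp (-(c * t)) *
        (V c (u t) * V c' (u t) - c / 2 * ((V c' (u t) - V c (u t)) ^ 2 / (c' - c))))
      (𝓝[Ici 0 \ {c}] c) (𝓝 (∫ t in Ioi 0, Real.exp (-(c * t)) * V c (u t) ^ 2)) := by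
    refine tendsto_integral_filter_of_dominated_convergence
      (fun t => κ * (b - a) * V c (u t) + A / 2 * (c * Real.exp (-(c * t)))) ?_ ?_ ?_ ?_
    · filter_upwards [hev] with c' hc'
      have h1 := hcV c hc
      have h2 := hcV c' hc'.1
      exact ((continuousOn_exp_neg c _).mul ((h1.mul h2).sub
        (continuousOn_const.mul (((h2.sub h1).pow 2).div_const _)))).aestronglyMeasurable
        measurableSet_Ioi
    · filter_upwards [hev] with c' hc'
      refine (ae_restrict_iff' measurableSet_Ioi).2 (Eventually.of_forall fun t ht => ?_)
      have ht : 0 < t := ht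
      have hx := IsProfile.orbit_mem hu hu0 ht.le
      have hV := ((h c hc).pos _ hx).le
      have hV' := ((h c' hc'.1).pos _ hx).le
      have hE : Real.exp (-(c * t)) ≤ 1 := exp_neg_mul_le_one hc ht.le
      have hne : 0 < |c' - c| := abs_pos.2 (sub_ne_zero.2 hc'.2)
      have h1 : ‖V c (u t) * V c' (u t)‖ ≤ κ * (b - a) * V c (u t) := by
        rw [Real.norm_of_nonneg (mul_nonneg hV hV'), mul_comm]
        gcongr
        exact (h c' hc'.1).le_const hx
      have h2 : ‖c / 2 * ((V c' (u t) - V c (u t)) ^ 2 / (c' - c))‖ ≤ c / 2 * A := by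
        rw [norm_mul, Real.norm_of_nonneg (by positivity : (0 : ℝ) ≤ c / 2), norm_div,
          Real.norm_of_nonneg (sq_nonneg _), Real.norm_eq_abs]
        gcongr
        rw [div_le_iff₀ hne]
        exact (h c hc).sq_sub_le_mul (h c' hc'.1) hc hc'.1 hx
      rw [mul_sub]
      refine (norm_sub_le _ _).trans (add_le_add ?_ ?_)
      · rw [norm_mul, Real.norm_of_nonneg (Real.exp_pos _).le]
        exact (mul_le_of_le_one_left (norm_nonneg _) hE).trans h1
      · rw [norm_mul, Real.norm_of_nonneg (Real.exp_pos _).le]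
        refine (mul_le_mul_of_nonneg_left h2 (Real.exp_pos _).le).trans_eq ?_
        ring
    · exact (((h c hc).integrableOn_orbit hu hu0).const_mul _).add
        ((integrableOn_mul_exp_neg hc).const_mul _)
    · refine (ae_restrict_iff' measurableSet_Ioi).2 (Eventually.of_forall fun t ht => ?_)
      have hx := IsProfile.orbit_mem hu hu0 (le_of_lt ht)
      have habs : Tendsto (fun c' => |c' - c|) (𝓝[Ici 0 \ {c}] c) (𝓝 0) := by
        have : Tendsto (fun c' => |c' - c|) (𝓝 c) (𝓝 |c - c|) :=
          (continuous_abs.comp (continuous_id.sub continuous_const)).tendsto c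
        rw [sub_self, abs_zero] at this
        exact this.mono_left nhdsWithin_le_nhds
      have h1 : Tendsto (fun c' => V c' (u t)) (𝓝[Ici 0 \ {c}] c) (𝓝 (V c (u t))) := by
        refine tendsto_iff_norm_sub_tendsto_zero.2 (squeeze_zero' (Eventually.of_forall fun _ =>
          norm_nonneg _) ?_ (by simpa using habs.const_mul (A / V c (u t))))
        filter_upwards [hev] with c' hc'
        exact (h c hc).abs_sub_le (h c' hc'.1) hc hc'.1 hx
      have h2 : Tendsto (fun c' => (V c' (u t) - V c (u t)) ^ 2 / (c' - c))
          (𝓝[Ici 0 \ {c}] c) (𝓝 0) := by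
        refine squeeze_zero_norm' ?_ (by simpa using habs.const_mul ((A / V c (u t)) ^ 2))
        filter_upwards [hev] with c' hc'
        have hne : 0 < |c' - c| := abs_pos.2 (sub_ne_zero.2 hc'.2)
        have := (h c hc).abs_sub_le (h c' hc'.1) hc hc'.1 hx
        rw [norm_div, norm_pow, Real.norm_eq_abs, Real.norm_eq_abs, div_le_iff₀ hne]
        calc _ ≤ (A / V c (u t) * |c' - c|) ^ 2 := by gcongr
          _ = _ := by ring
      have := ((h1.const_mul (V c (u t))).sub (h2.const_mul (c / 2))).const_mul
        (Real.exp (-(c * t)))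
      convert this using 2
      ring
  have hsq : HasDerivWithinAt (fun c' => V c' (u 0) ^ 2)
      (-(2 * ∫ t in Ioi 0, Real.exp (-(c * t)) * V c (u t) ^ 2)) (Ici 0) c := by
    rw [hasDerivWithinAt_iff_tendsto_slope]
    refine (hlim.const_mul 2).neg.congr' ?_
    filter_upwards [hev] with c' hc'
    have hne : c' - c ≠ 0 := sub_ne_zero.2 hc'.2
    have h1 : ∀ t, Real.exp (-(c * t)) *
        (V c (u t) * V c' (u t) - c / 2 * ((V c' (u t) - V c (u t)) ^ 2 / (c' - c))) =
        IsProfile.gapIntegrand c c' (V c) (V c') u t / (c' - c) := fun t => by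
      rw [IsProfile.gapIntegrand]
      field_simp
    simp_rw [h1]
    rw [integral_div, (h c hc).integral_gapIntegrand (h c' hc'.1) hc hu hu0, slope_def_field]
    field_simp
    ring
  have hV := (h c hc).pos _ hu0
  -- The derivative of V² passes to V because V > 0 at the starting point.
  have hsqrt : ∀ c' ∈ Ici (0 : ℝ), V c' (u 0) = √(V c' (u 0) ^ 2) := fun c' hc' =>
    (Real.sqrt_sq ((h c' hc').pos _ hu0).le).symm
  refine ((hsq.sqrt (by positivity)).congr hsqrt (hsqrt c hc)).congr_deriv ?_
  rw [Real.sqrt_sq hV.le]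
  field_simp

/-! ### From the hypotheses on F to the separatrix -/

theorem exists_left_extension {F : ℝ → ℝ} {W : Set ℝ} {θhl θp : ℝ} (hθ : θhl < θp)
    (hW : IsOpen W) (hIW : Icc θhl θp ⊆ W) (hF : ContDiffOn ℝ ∞ F W)
    (hzero : ∀ x ∈ W, F x = 0 ↔ x = θp) (hF' : deriv F θp < 0) :
    (∀ᶠ x in 𝓝[>] θp, F x < 0) ∧ ∃ a < θhl, Icc a θp ⊆ W ∧ (∀ x ∈ Ioo a θp, 0 < F x) ∧
      ∃ C, 0 ≤ C ∧ ∀ x ∈ Icc a θp, F x ≤ C * (θp - x) := by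
  have hθW : θp ∈ W := hIW ⟨hθ.le, le_rfl⟩
  have hF0 : F θp = 0 := (hzero θp hθW).2 rfl
  have hdW : ∀ x ∈ W, DifferentiableAt ℝ F x := fun x hx =>
    (hF.contDiffAt (hW.mem_nhds hx)).differentiableAt (by simp)
  have hslope := (hasDerivAt_iff_tendsto_slope.1 (hdW θp hθW).hasDerivAt).eventually_lt_const hF'
  have hright : ∀ᶠ x in 𝓝[>] θp, F x < 0 := by
    filter_upwards [hslope.filter_mono (nhdsWithin_mono _ fun x hx => ne_of_gt hx),
      self_mem_nhdsWithin] with x hx hlt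
    rw [slope_def_field, hF0, sub_zero, div_neg_iff] at hx
    have : θp < x := hlt
    rcases hx with hx | hx <;> linarith
  have hleft : ∀ᶠ x in 𝓝[<] θp, 0 < F x := by
    filter_upwards [hslope.filter_mono (nhdsWithin_mono _ fun x hx => ne_of_lt hx),
      self_mem_nhdsWithin] with x hx hlt
    rw [slope_def_field, hF0, sub_zero, div_neg_iff] at hx
    have : x < θp := hlt
    rcases hx with hx | hx <;> linarith
  -- Moving the left end beyond θ_hl makes θ_hl an interior point, where the profile equation holds
  -- with two-sided derivatives.
  obtain ⟨ε, hε, hball⟩ := Metric.isOpen_iff.1 hW θhl (hIW ⟨le_rfl, hθ.le⟩)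
  have hsub : Icc (θhl - ε / 2) θp ⊆ W := by
    intro x hx
    by_cases h : θhl ≤ x
    · exact hIW ⟨h, hx.2⟩
    · apply hball
      rw [Metric.mem_ball, Real.dist_eq, abs_lt]
      constructor <;> linarith [hx.1]
  refine ⟨hright, θhl - ε / 2, by linarith, hsub, fun x hx => ?_, ?_⟩
  · by_contra! hneg
    obtain ⟨y, hy0, hy⟩ := (hleft.and (Ioo_mem_nhdsLT hx.2)).exists
    have hxy : Icc x y ⊆ W := (Icc_subset_Icc hx.1.le hy.2.le).trans hsub
    obtain ⟨z, hz, hz0⟩ := intermediate_value_Icc hy.1.le (hF.continuousOn.mono hxy)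
      ⟨hneg, hy0.le⟩
    linarith [(hzero z (hxy hz)).1 hz0, hz.2, hy.2]
  · have hcd : ContinuousOn (deriv F) (Icc (θhl - ε / 2) θp) :=
      (hF.continuousOn_deriv_of_isOpen hW (by simp)).mono hsub
    obtain ⟨C, hC⟩ := isCompact_Icc.exists_bound_of_continuousOn hcd
    have hmem : θp ∈ Icc (θhl - ε / 2) θp := ⟨by linarith, le_rfl⟩
    refine ⟨C, (norm_nonneg _).trans (hC θp hmem), fun x hx => ?_⟩
    have := (convex_Icc _ _).norm_image_sub_le_of_norm_deriv_le (fun y hy => hdW y (hsub hy)) hC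
      hmem hx
    rw [hF0, sub_zero, Real.norm_eq_abs, Real.norm_eq_abs, abs_sub_comm,
      abs_of_nonneg (sub_nonneg.2 hx.2)] at this
    exact (le_abs_self _).trans this

section

variable {F V : ℝ → ℝ} {W : Set ℝ} {a θhl b κ c : ℝ}

theorem right_mem_stableManifold (hbW : b ∈ W) (hFb : F b = 0) :
    (b, 0) ∈ stableManifold F W b c := by
  refine ⟨fun _ => (b, 0), ⟨fun _ _ => hbW, fun t _ => ?_⟩, rfl, tendsto_const_nhds⟩
  refine (hasDerivWithinAt_const _ _ _).congr_deriv ?_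
  ext <;> simp [field, hFb]

/-- Over [θ_hl, b) this is `mem_profile` one way and `exists_trajectory` the other. Over b, the
ordinate is nonpositive by `snd_nonpos_of_fst_eq` and nonnegative by definition, and the equilibrium
realises 0. -/
theorem mem_stableSeparatrix_iff (hc : 0 ≤ c) (hF : ContinuousOn F W)
    (hzero : ∀ x ∈ W, F x = 0 ↔ x = b) (hright : ∀ᶠ x in 𝓝[>] b, F x < 0)
    (hW : Icc a b ⊆ W) (ha : a < θhl) (hab : θhl < b) (hF0 : ∀ x ∈ Ioo a b, 0 < F x)
    (hV : IsProfile F a b κ c V) {p : ℝ × ℝ} :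
    p ∈ stableSeparatrix F W θhl b c ↔ p.1 ∈ Icc θhl b ∧ p.2 = V p.1 := by
  have hbW : b ∈ W := hW ⟨(ha.trans hab).le, le_rfl⟩
  obtain ⟨x, y⟩ := p
  constructor
  · rintro ⟨⟨γ, hγ, hγ0, hlim⟩, hx, hy⟩
    refine ⟨hx, ?_⟩
    have hx : x ∈ Icc θhl b := hx
    have hy : 0 ≤ y := hy
    rcases hx.2.eq_or_lt with rfl | hlt
    · have := hγ.snd_nonpos_of_fst_eq hc hF (fun z hz => (hzero z hz).1) hright
        ((continuous_fst.tendsto _).comp hlim) le_rfl (by rw [hγ0])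
      rw [hγ0] at this
      simp only [hV.right_eq]
      exact le_antisymm this hy
    · have := (hγ.mem_profile hc hF (fun z hz => (hzero z hz).1) hright hV hF0 hlim
        (by rw [hγ0]; exact ⟨ha.trans_le hx.1, hlt⟩) 0 le_rfl).2
      rwa [hγ0] at this
  · rintro ⟨hx, hy⟩
    have hx : x ∈ Icc θhl b := hx
    have hy : y = V x := hy
    subst hy
    rcases hx.2.eq_or_lt with rfl | hlt
    · rw [hV.right_eq]
      exact ⟨right_mem_stableManifold hbW ((hzero _ hbW).2 rfl), hx,
        self_mem_Ici⟩
    · have hx' : x ∈ Ioo a b := ⟨ha.trans_le hx.1, hlt⟩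
      exact ⟨hV.exists_trajectory hW hx', hx, (hV.pos x hx').le⟩

theorem height_eq (hc : 0 ≤ c) (hF : ContinuousOn F W)
    (hzero : ∀ x ∈ W, F x = 0 ↔ x = b) (hright : ∀ᶠ x in 𝓝[>] b, F x < 0)
    (hW : Icc a b ⊆ W) (ha : a < θhl) (hab : θhl < b) (hF0 : ∀ x ∈ Ioo a b, 0 < F x)
    (hV : IsProfile F a b κ c V) {x : ℝ} (hx : x ∈ Icc θhl b) :
    height F W θhl b x c = V x := by
  have : {y | (x, y) ∈ stableSeparatrix F W θhl b c} = {V x} := by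
    ext y
    rw [mem_ofPred_eq, mem_stableSeparatrix_iff hc hF hzero hright hW ha hab hF0 hV]
    simp [hx.1, hx.2]
  rw [height, this, csSup_singleton]

end

/-- A trajectory along a profile passes exactly once over each point between its start and `b`. -/
theorem IsOrbit.existsUnique_time {V u : ℝ → ℝ} {b x : ℝ} (hu : IsOrbit V b u)
    (hpos : ∀ t, 0 < t → 0 < V (u t)) (hx : x ∈ Ico (u 0) b) :
    ∃! τ : ℝ, 0 ≤ τ ∧ u τ = x := by
  have hmono : StrictMonoOn u (Ici 0) := by
    refine strictMonoOn_of_deriv_pos (convex_Ici 0) hu.continuousOn fun t ht => ?_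
    rw [interior_Ici] at ht
    rw [(hu.hasDerivAt t ht).deriv]
    exact hpos t ht
  obtain ⟨T, hT, hT0⟩ := ((hu.lim.eventually_const_lt hx.2).and (eventually_ge_atTop 0)).exists
  obtain ⟨τ, hτ, rfl⟩ := intermediate_value_Icc hT0
    (hu.continuousOn.mono Icc_subset_Ici_self) ⟨hx.1, hT.le⟩
  exact ⟨τ, ⟨hτ.1, rfl⟩, fun σ hσ => hmono.injOn hσ.1 hτ.1 hσ.2⟩

theorem IsForwardTrajectory.isOrbit {F V : ℝ → ℝ} {W : Set ℝ} {c b : ℝ} {γ : ℝ → ℝ × ℝ}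
    (h : IsForwardTrajectory F W c γ) (hlim : Tendsto γ atTop (𝓝 (b, 0)))
    (hγ : ∀ t, 0 ≤ t → (γ t).1 ∈ Ico (γ 0).1 b ∧ (γ t).2 = V (γ t).1) :
    IsOrbit V b (fun t => (γ t).1) :=
  ⟨fun t ht => (hγ t ht).1, h.continuousOn_fst,
    fun t ht => by simpa only [(hγ t (le_of_lt ht)).2] using h.hasDerivAt_fst ht,
    (continuous_fst.tendsto _).comp hlim⟩

end Separatrix

theorem proposition4p3 (F : ℝ → ℝ) (W : Set ℝ) (θhl θp : ℝ)
    (hθ : θhl < θp) (hW : IsOpen W) (hIW : Icc θhl θp ⊆ W)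
    (hF : ContDiffOn ℝ ∞ F W)
    (hzero : ∀ x ∈ W, F x = 0 ↔ x = θp)
    (hF' : deriv F θp < 0) :
    -- for each `c ≥ 0`, the separatrix is the graph of `v(·, c)` over `[θhl, θp]`,
    -- and the trajectory `γ_c` exists
    (∀ c : ℝ, 0 ≤ c →
      Separatrix.stableSeparatrix F W θhl θp c =
        {p : ℝ × ℝ | p.1 ∈ Icc θhl θp ∧ p.2 = Separatrix.height F W θhl θp p.1 c} ∧
      ∃ γ : ℝ → ℝ × ℝ, Separatrix.IsSeparatrixTrajectory F W θhl θp c γ) ∧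
    ∀ u ∈ Ico θhl θp, ∀ c : ℝ, 0 ≤ c →
      0 < Separatrix.height F W θhl θp u c ∧
      derivWithin (fun c' => Separatrix.height F W θhl θp u c') (Ici 0) c < 0 ∧
      ∀ γ : ℝ → ℝ × ℝ, Separatrix.IsSeparatrixTrajectory F W θhl θp c γ →
        (∃! τ : ℝ, 0 ≤ τ ∧ (γ τ).1 = u) ∧
        ∀ τ : ℝ, 0 ≤ τ → (γ τ).1 = u →
          IntegrableOn (fun t => Real.exp (-(c * t)) * (γ (t + τ)).2 ^ 2) (Ioi 0) ∧
          HasDerivWithinAt (fun c' => Separatrix.height F W θhl θp u c')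
            (-(1 / Separatrix.height F W θhl θp u c) *
              ∫ t in Ioi (0 : ℝ), Real.exp (-(c * t)) * (γ (t + τ)).2 ^ 2)
            (Ici 0) c := by
  obtain ⟨hright, a, ha, haW, hF0, C, hC, hFC⟩ :=
    Separatrix.exists_left_extension hθ hW hIW hF hzero hF'
  have hFc := hF.continuousOn
  have hzero' : ∀ x ∈ W, F x = 0 → x = θp := fun x hx => (hzero x hx).1
  have hex : ∀ c, ∃ V, 0 ≤ c → Separatrix.IsProfile F a θp (√C) c V := fun c => by
    by_cases hc : 0 ≤ c
    · obtain ⟨V, hV⟩ := Separatrix.exists_isProfile (hFc.mono haW) (ha.trans hθ).le hC hFC hF0 hc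
      exact ⟨V, fun _ => hV⟩
    · exact ⟨0, fun h => absurd h hc⟩
  choose V hV using hex
  have hheight : ∀ c, 0 ≤ c → ∀ x ∈ Icc θhl θp, Separatrix.height F W θhl θp x c = V c x :=
    fun c hc x hx => Separatrix.height_eq hc hFc hzero hright haW ha hθ hF0 (hV c hc) hx
  have hθhl : θhl ∈ Icc θhl θp := ⟨le_rfl, hθ.le⟩
  have hexγ : ∀ c, 0 ≤ c → ∃ γ, Separatrix.IsSeparatrixTrajectory F W θhl θp c γ := fun c hc => by
    obtain ⟨γ, hγ, hγ0, hlim⟩ := (hV c hc).exists_trajectory haW ⟨ha, hθ⟩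
    exact ⟨γ, hγ, by rw [hγ0, hheight c hc θhl hθhl], hlim⟩
  have hprofile : ∀ c, 0 ≤ c → ∀ γ, Separatrix.IsSeparatrixTrajectory F W θhl θp c γ →
      ∀ t, 0 ≤ t → (γ t).1 ∈ Ico (γ 0).1 θp ∧ (γ t).2 = V c (γ t).1 := fun c hc γ hγ =>
    hγ.traj.mem_profile hc hFc hzero' hright (hV c hc) hF0 hγ.lim
      (by rw [hγ.init]; exact ⟨ha, hθ⟩)
  have hpast : ∀ u ∈ Ico θhl θp, ∀ c, 0 ≤ c → ∀ γ,
      Separatrix.IsSeparatrixTrajectory F W θhl θp c γ → ∃! τ : ℝ, 0 ≤ τ ∧ (γ τ).1 = u := by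
    intro u hu c hc γ hγ
    have hp := hprofile c hc γ hγ
    have h0 : (γ 0).1 = θhl := by rw [hγ.init]
    refine (hγ.traj.isOrbit hγ.lim hp).existsUnique_time (fun t ht => ?_) (by rwa [h0])
    have := (hp t ht.le).1
    rw [h0] at this
    exact (hV c hc).pos _ ⟨ha.trans_le this.1, this.2⟩
  have hmain : ∀ u ∈ Ico θhl θp, ∀ c, 0 ≤ c → ∀ γ,
      Separatrix.IsSeparatrixTrajectory F W θhl θp c γ → ∀ τ : ℝ, 0 ≤ τ → (γ τ).1 = u →
        IntegrableOn (fun t => Real.exp (-(c * t)) * (γ (t + τ)).2 ^ 2) (Ioi 0) ∧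
        0 < ∫ t in Ioi (0 : ℝ), Real.exp (-(c * t)) * (γ (t + τ)).2 ^ 2 ∧
        HasDerivWithinAt (fun c' => Separatrix.height F W θhl θp u c')
          (-(1 / Separatrix.height F W θhl θp u c) *
            ∫ t in Ioi (0 : ℝ), Real.exp (-(c * t)) * (γ (t + τ)).2 ^ 2) (Ici 0) c := by
    intro u hu c hc γ hγ τ hτ hτu
    have hmem : u ∈ Ioo a θp := ⟨ha.trans_le hu.1, hu.2⟩
    -- Restarting the clock at τ gives an orbit whose initial abscissa is u, as the derivative
    -- formula requires.
    have hshift := hγ.traj.shift hτ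
    have hlim : Tendsto (fun t => γ (t + τ)) atTop (𝓝 (θp, 0)) :=
      hγ.lim.comp (tendsto_atTop_add_const_right _ _ tendsto_id)
    have h0 : (γ (0 + τ)).1 = u := by rw [zero_add, hτu]
    have hp := hshift.mem_profile hc hFc hzero' hright (hV c hc) hF0 hlim (by rwa [h0])
    have horb := hshift.isOrbit hlim hp
    have hu0 : (γ (0 + τ)).1 ∈ Ioo a θp := by rwa [h0]
    have heq : EqOn (fun t => Real.exp (-(c * t)) * V c (γ (t + τ)).1 ^ 2)
        (fun t => Real.exp (-(c * t)) * (γ (t + τ)).2 ^ 2) (Ioi 0) := fun t ht => by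
      simp only [(hp t (le_of_lt ht)).2]
    rw [← setIntegral_congr_fun measurableSet_Ioi heq]
    refine ⟨((hV c hc).integrableOn_exp_mul_sq hc horb hu0).congr_fun heq measurableSet_Ioi,
      (hV c hc).integral_exp_mul_sq_pos hc horb hu0, ?_⟩
    have hd := Separatrix.hasDerivWithinAt_profile hV hc horb hu0
    simp only [h0] at hd
    have huI : u ∈ Icc θhl θp := Ico_subset_Icc_self hu
    rw [hheight c hc u huI]
    exact hd.congr (fun c' hc' => hheight c' hc' u huI) (hheight c hc u huI)
  refine ⟨fun c hc => ⟨?_, hexγ c hc⟩, fun u hu c hc => ?_⟩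
  · ext p
    rw [Separatrix.mem_stableSeparatrix_iff hc hFc hzero hright haW ha hθ hF0 (hV c hc),
      mem_ofPred_eq]
    exact and_congr_right fun hp => by rw [hheight c hc _ hp]
  · have hpos : 0 < Separatrix.height F W θhl θp u c := by
      rw [hheight c hc u (Ico_subset_Icc_self hu)]
      exact (hV c hc).pos u ⟨ha.trans_le hu.1, hu.2⟩
    refine ⟨hpos, ?_, fun γ hγ => ⟨hpast u hu c hc γ hγ, fun τ hτ hτu => ?_⟩⟩
    · obtain ⟨γ, hγ⟩ := hexγ c hc
      obtain ⟨τ, ⟨hτ, hτu⟩, -⟩ := hpast u hu c hc γ hγ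
      obtain ⟨-, hint, hd⟩ := hmain u hu c hc γ hγ τ hτ hτu
      rw [hd.derivWithin (uniqueDiffOn_Ici 0 c hc)]
      exact mul_neg_of_neg_of_pos (neg_neg_of_pos (one_div_pos.2 hpos)) hint
    · obtain ⟨hi, -, hd⟩ := hmain u hu c hc γ hγ τ hτ hτu
      exact ⟨hi, hd⟩
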